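/- **Network.** $N\ge 1$ nodes send packets of 1 bit to an access point (AP). The direct rate of node $k$ is $R_k>0$, the rate from $k$ to $l\neq k$ is $R_{kl}>0$, and $\mathcal E$ is the common transmit power. A node $h\ne k$ is a best relay of $k$ if it minimizes $1/R_{kl}+1/R_l$ over $l\neq k$ and $1/R_{kh}+1/R_h<1/R_k$. A node that has a best relay uses one of them as its helper $h_k$; let $\mathcal C$ be the set of these nodes and $\mathcal D$ the set of all others. Helpers are assumed to belong to $\mathcal D$. Let $H_k$ be the number of nodes $j$ with $h_j=k$. Put $u_k=1/R_k$, $s_k=1/R_k$, $t_k=(H_k+1)/R_k$ for $k\in\mathcal D$, and $u_k=t_k=1/R_{kh_k}$, $s_k=1/R_{kh_k}+1/R_{h_k}$ for $k\in\mathcal C$. **Reference protocols.** Round Robin CoopMAC has per-node throughput $1/\sum_l s_l$, average powers $t_k\mathcal E/\sum_l s_l$ and bit-costs equal to average power divided by throughput. CSMA CoopMAC with slot length $\sigma$ and transmit probability $\tau$ has, with $p_s=\tau(1-\tau)^{N-1}$, the throughput $\mathsf S^{\mathrm{coop}}=p_s/(\bar t_s+\bar t_c+\bar t_i)$ and the bit-costs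 $\mathsf B_k^{\mathrm{coop}}=(H_k+\tau/p_s)u_k\mathcal E$, where $\bar t_s=\sum_k p_s(s_k+\sigma)$, $\bar t_i=(1-\tau)^N\sigma$ and $\bar t_c=\sum_{|A|\ge2}\tau^{|A|}(1-\tau)^{N-|A|}(\max_{k\in A}u_k+\sigma)$, the sum being over sets $A$ of nodes. **fairMAC$_\infty$** (unlimited numbers $P=Q=\infty$ of pending packets and of packets forwarded at a time). Time is divided into phases; in each phase each node independently transmits with probability $\tau$. A phase lasts $\sigma$ if no node transmits; otherwise it lasts $\sigma$ plus the length of the longest transmitted packet. A transmission succeeds iff no other node transmits in the phase. Every $k\in\mathcal D$ has a forwarding queue, initially empty, of length $X_k$. A node $k\in\mathcal C$ transmits a packet of length $v_k=1/R_{kh_k}$, which upon success is added to the queue of $h_k$. A node $k\in\mathcal D$ transmits one own bit jointly with all packets of its queue, with packet length $v_k=(X_k+1)/R_k$; upon success all these bits reach the AP and the queue is emptied. The throughput of $k$ is the almost sure long-run number of bits of $k$ that reach the AP per time; the average power of $k$ is the almost sure long-run value of $\mathcal E$ times the transmission time of $k$ (collisions and forwarding included) per time; the bit-cost of $k$ is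 its average power divided by its throughput. **Proposition.** Let $\tau=c\sqrt\sigma$ with a constant $c>0$. For all $\sigma>0$ with $c\sqrt\sigma<1$, in fairMAC$_\infty$ all nodes have the same, positive throughput $\mathsf S^{\mathrm{fair}_\infty}(\sigma)$ and each node $k$ has a bit-cost $\mathsf B_k^{\mathrm{fair}_\infty}(\sigma)$ (the almost sure limits exist). For each such $\sigma$, the queue length $X_k$ seen by $k$ just before it transmits has steady-state mean $\mathbb E[X_k]=H_k$ (the limit, as $m\to\infty$, of the conditional mean of $X_k$ before phase $m$ given that $k$ transmits in phase $m$), and the steady-state mean $\mathbb E[\sum_k v_k]$ (the limit, as $m\to\infty$, of the mean of $\sum_kv_k$ before phase $m$) exists and does not depend on $\sigma$. Moreover, fairMAC$_\infty$ asymptotically reaches the operating point of Round Robin CoopMAC and of CSMA CoopMAC: $$\lim_{\sigma\to0}\mathsf S^{\mathrm{fair}_\infty}(\sigma)=\frac1{\mathbb E[\sum_k v_k]}=\frac{1}{\sum_{k\in\mathcal D}\frac1{R_k}+\sum_{k\in\mathcal C}\bigl(\frac1{R_{kh_k}}+\frac1{R_{h_k}}\bigr)}=\frac1{\sum_k s_k}=\lim_{\sigma\to0}\mathsf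 S^{\mathrm{coop}},$$ and for every node $k$ $$\lim_{\sigma\to0}\mathsf B^{\mathrm{fair}_\infty}_k(\sigma)=(H_k+1)u_k\mathcal E=\lim_{\sigma\to0}\mathsf B_k^{\mathrm{coop}},$$ which is also the bit-cost of $k$ in Round Robin CoopMAC. -/

import Mathlib

open Filter Topology MeasureTheory ProbabilityTheory

/-- The data of a wireless network whose nodes are the elements of `ι` and which has one access
point (AP). Rates are in bit/s and every data packet carries one bit. -/
structure RelayNetwork (ι : Type*) where
  /-- `rate k` is the rate `R_k` from node `k` to the AP. -/
  rate : ι → ℝ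
  /-- `linkRate k l` is the rate `R_{kl}` from node `k` to node `l` (only used for `k ≠ l`). -/
  linkRate : ι → ι → ℝ
  /-- `helper k = some h` means that node `k` has the helper `h_k = h`; `helper k = none` means that
  node `k` has no helper. -/
  helper : ι → Option ι
  /-- The transmit power, common to all nodes. -/
  power : ℝ

noncomputable section

namespace RelayNetwork

variable {ι : Type*} [Fintype ι] [DecidableEq ι] (net : RelayNetwork ι)

/-! ### Helpers -/

/-- Overall transmission time from `k` to the AP via `h`. -/
def twoHopTime (k h : ι) : ℝ := 1 / net.linkRate k h + 1 / net.rate h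

/-- `h` minimizes the two-hop transmission time of `k` over all other nodes, and transmitting via
`h` is strictly faster than transmitting directly. -/
def IsBestRelay (k h : ι) : Prop :=
  h ≠ k ∧ (∀ l, l ≠ k → net.twoHopTime k h ≤ net.twoHopTime k l) ∧
    net.twoHopTime k h < 1 / net.rate k

/-- Each node has a best relay as its helper, if a best relay exists, and no helper otherwise. Ties
between best relays are broken arbitrarily. -/
def HelpersAreBestRelays : Prop :=
  (∀ k h, net.helper k = some h → net.IsBestRelay k h) ∧
    ∀ k, net.helper k = none → ∀ h, ¬ net.IsBestRelay k h

/-- `H_k`: the number of nodes whose helper is `k`. -/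
def helpedCount (k : ι) : ℕ := (Finset.univ.filter fun j => net.helper j = some k).card

/-- The travel time `s_k` of one bit of node `k` in CoopMAC. -/
def travelTime (k : ι) : ℝ :=
  match net.helper k with
  | some h => 1 / net.linkRate k h + 1 / net.rate h
  | none => 1 / net.rate k

/-- The packet duration `u_k` in CoopMAC. -/
def packetDuration (k : ι) : ℝ :=
  match net.helper k with
  | some h => 1 / net.linkRate k h
  | none => 1 / net.rate k

/-! ### Round Robin CoopMAC -/

/-- The time `t_k` for which node `k` is transmitting in one round. -/
def rrTransmissionTime (k : ι) : ℝ :=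
  match net.helper k with
  | some h => 1 / net.linkRate k h
  | none => (net.helpedCount k + 1) / net.rate k

/-- Per-node throughput of Round Robin CoopMAC: one bit per node and round. -/
def rrThroughput : ℝ := 1 / ∑ k, net.travelTime k

/-- Average power of node `k` in Round Robin CoopMAC. -/
def rrAveragePower (k : ι) : ℝ :=
  net.rrTransmissionTime k * net.power / ∑ l, net.travelTime l

/-- Bit-cost of node `k` in Round Robin CoopMAC. -/
def rrBitCost (k : ι) : ℝ := net.rrAveragePower k / net.rrThroughput

/-! ### CSMA CoopMAC with slot length `σ` and transmit probability `τ` -/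

/-- The largest of the numbers `len k`, `k ∈ A`, and zero if `A` is empty. -/
def maxLength (len : ι → ℝ) (A : Finset ι) : ℝ :=
  if h : A.Nonempty then A.sup' h len else 0

/-- The probability `p_s` that one specific node transmits successfully in a given phase. -/
def successProb (ι : Type*) [Fintype ι] (τ : ℝ) : ℝ := τ * (1 - τ) ^ (Fintype.card ι - 1)

/-- Average time that one phase is idle. -/
def coopIdleTime (ι : Type*) [Fintype ι] (σ τ : ℝ) : ℝ := (1 - τ) ^ Fintype.card ι * σ

/-- Average time of successful transmission in one phase. -/
def coopSuccessTime (σ τ : ℝ) : ℝ := ∑ k, successProb ι τ * (net.travelTime k + σ)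

/-- Average collision time in one phase: a sum over the sets `A` of at least two nodes that
transmit simultaneously; the longest of the colliding packets determines the duration. -/
def coopCollisionTime (σ τ : ℝ) : ℝ :=
  ∑ A ∈ (Finset.univ : Finset ι).powerset.filter (fun A => 2 ≤ A.card),
    τ ^ A.card * (1 - τ) ^ (Fintype.card ι - A.card) * (maxLength net.packetDuration A + σ)

/-- Per-node throughput of CSMA CoopMAC. -/
def coopThroughput (σ τ : ℝ) : ℝ :=
  successProb ι τ / (net.coopSuccessTime σ τ + net.coopCollisionTime σ τ + coopIdleTime ι σ τ)

/-- Bit-cost of node `k` in CSMA CoopMAC. -/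
def coopBitCost (τ : ℝ) (k : ι) : ℝ :=
  (net.helpedCount k + τ / successProb ι τ) * net.packetDuration k * net.power

/-! ### fairMAC with at most `P` pending packets and at most `Q` packets forwarded at a time

The state is the family of forwarding queues. The queue of node `h` is the list of the sources of
the packets waiting at `h`, the oldest packet first. In each phase a subset of the nodes initiates
a transmission; `a k = true` means that node `k` does. -/

/-- The number `p` of pending packets of node `k`: the packets of `k` that wait at its helper. -/
def pending (q : ι → List ι) (k : ι) : ℕ :=
  match net.helper k with
  | some h => (q h).count k
  | none => 0

/-- The node to which `k` addresses its next packet; `none` stands for the AP. -/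
def nextHop (P : ℕ∞) (q : ι → List ι) (k : ι) : Option ι :=
  if (net.pending q k : ℕ∞) < P then net.helper k else none

/-- The packets from the forwarding queue of `k` that are put into the next joint packet. -/
def jointPart (Q : ℕ∞) (q : ι → List ι) (k : ι) : List ι :=
  (q k).take (min Q ((q k).length : ℕ∞)).toNat

/-- Length `v_k` of the packet that `k` transmits when the queues are `q`: one own bit to the
helper, or a joint packet of one own bit and the forwarded bits to the AP. -/
def packetLength (P Q : ℕ∞) (q : ι → List ι) (k : ι) : ℝ :=
  match net.nextHop P q k with
  | some h => 1 / net.linkRate k h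
  | none => ((jointPart Q q k).length + 1) / net.rate k

/-- The set of nodes that transmit in a phase. -/
def transmitters (a : ι → Bool) : Finset ι := Finset.univ.filter fun k => a k = true

/-- The node that transmits successfully, that is, alone, in a phase (if there is one). -/
def soleTransmitter (a : ι → Bool) : Option ι :=
  if h : ∃ k, transmitters a = {k} then some h.choose else none

/-- The forwarding queues after a phase. In an idle phase and in a collision nothing changes. A
successful transmission to a helper appends one packet to the queue of the helper; a successful
joint packet removes the forwarded packets from the queue of the transmitter. -/
def nextQueues (P Q : ℕ∞) (q : ι → List ι) (a : ι → Bool) : ι → List ι :=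
  match soleTransmitter a with
  | none => q
  | some k =>
    match net.nextHop P q k with
    | some h => Function.update q h (q h ++ [k])
    | none => Function.update q k ((q k).drop (jointPart Q q k).length)

/-- Duration of a phase: one slot if it is idle; otherwise the longest of the transmitted packets,
followed by one idle slot. -/
def phaseDuration (P Q : ℕ∞) (σ : ℝ) (q : ι → List ι) (a : ι → Bool) : ℝ :=
  maxLength (net.packetLength P Q q) (transmitters a) + σ

/-- The number of data bits that belong to `k` and reach the AP during a phase. -/
def phaseBits (P Q : ℕ∞) (k : ι) (q : ι → List ι) (a : ι → Bool) : ℕ :=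
  match soleTransmitter a with
  | none => 0
  | some j =>
    match net.nextHop P q j with
    | some _ => 0
    | none => (if j = k then 1 else 0) + (jointPart Q q j).count k

/-- The time for which `k` is transmitting during a phase (be it with or without success). -/
def phaseAirtime (P Q : ℕ∞) (k : ι) (q : ι → List ι) (a : ι → Bool) : ℝ :=
  if a k = true then net.packetLength P Q q k else 0

/-- The forwarding queues just before phase `n`; they are empty at the beginning. -/
def queues (P Q : ℕ∞) (ω : ℕ → ι → Bool) : ℕ → ι → List ι
  | 0 => fun _ => []
  | n + 1 => net.nextQueues P Q (queues P Q ω n) (ω n)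

/-- Total duration of the first `n` phases. -/
def elapsedTime (P Q : ℕ∞) (σ : ℝ) (n : ℕ) (ω : ℕ → ι → Bool) : ℝ :=
  ∑ m ∈ Finset.range n, net.phaseDuration P Q σ (net.queues P Q ω m) (ω m)

/-- The number of data bits of `k` that reach the AP in the first `n` phases. -/
def deliveredBits (P Q : ℕ∞) (k : ι) (n : ℕ) (ω : ℕ → ι → Bool) : ℕ :=
  ∑ m ∈ Finset.range n, net.phaseBits P Q k (net.queues P Q ω m) (ω m)

/-- The time for which `k` is transmitting in the first `n` phases. -/
def airtime (P Q : ℕ∞) (k : ι) (n : ℕ) (ω : ℕ → ι → Bool) : ℝ :=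
  ∑ m ∈ Finset.range n, net.phaseAirtime P Q k (net.queues P Q ω m) (ω m)

/-- Law of the access decisions: in each phase each node initiates a transmission with
probability `τ`, independently over nodes and phases. -/
def accessLaw (ι : Type*) [Fintype ι] (τ : unitInterval) : Measure (ℕ → ι → Bool) :=
  Measure.infinitePi fun _ : ℕ => Measure.infinitePi fun _ : ι => bernoulliMeasure true false τ

/-- The throughput of node `k` in fairMAC is `S`: with probability one, the number of delivered bits
of `k` per time converges to `S`. -/
def HasThroughput (P Q : ℕ∞) (σ : ℝ) (τ : unitInterval) (k : ι) (S : ℝ) : Prop :=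
  ∀ᵐ ω ∂(accessLaw ι τ), Tendsto
    (fun n => (net.deliveredBits P Q k n ω : ℝ) / net.elapsedTime P Q σ n ω) atTop (𝓝 S)

/-- The average power of node `k` in fairMAC is `E`: with probability one, transmit power times
transmission time of `k` per overall time converges to `E`. -/
def HasAveragePower (P Q : ℕ∞) (σ : ℝ) (τ : unitInterval) (k : ι) (E : ℝ) : Prop :=
  ∀ᵐ ω ∂(accessLaw ι τ), Tendsto
    (fun n => net.power * net.airtime P Q k n ω / net.elapsedTime P Q σ n ω) atTop (𝓝 E)

/-- The bit-cost of node `k` in fairMAC is `B`: the average power divided by the throughput. -/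
def HasBitCost (P Q : ℕ∞) (σ : ℝ) (τ : unitInterval) (k : ι) (B : ℝ) : Prop :=
  ∃ E S, net.HasAveragePower P Q σ τ k E ∧ net.HasThroughput P Q σ τ k S ∧ 0 < S ∧ B = E / S

/-- Mean length of the forwarding queue of `k` just before phase `m`, given that `k` transmits in
phase `m`. -/
def meanQueueAtTransmission (P Q : ℕ∞) (τ : unitInterval) (k : ι) (m : ℕ) : ℝ :=
  ∫ ω, ((net.queues P Q ω m k).length : ℝ) ∂(cond (accessLaw ι τ) {ω | ω m k = true})

/-- Mean of the sum over all nodes of the packet lengths `v_k` determined by the queues just before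
phase `m`. -/
def meanTotalPacketLength (P Q : ℕ∞) (τ : unitInterval) (m : ℕ) : ℝ :=
  ∫ ω, ∑ k, net.packetLength P Q (net.queues P Q ω m) k ∂(accessLaw ι τ)

end RelayNetwork

end

/-!
Let `p = τ (1 - τ) ^ (N - 1)` be the probability that a given node transmits successfully in a
phase. Without limits on pending and forwarded packets, the length `X` of the forwarding queue of
`k` satisfies the linear recursion `X (m + 1) = (1 - s) X m + b` (`queueLen_succ`), where `s` and `b`
indicate a success of `k` and of a node helped by `k` in phase `m`; both are independent of `X m`.
Taking means, `E[X m] = H_k (1 - (1 - p) ^ m)`, which tends to `H_k`, and the second moments stay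
bounded. Hence the mean of the sum of all packet lengths tends to `V = ∑ k, u_k (H_k + 1)`, which is
`∑ k, s_k` by double counting (`sum_travelTime`).

Almost sure limits rest on one law of large numbers, for square integrable sequences that are
uncorrelated beyond a fixed lag (`ae_tendsto_average_of_uncorrelated`). It applies to functionals of
finitely many coordinates of the i.i.d. access decisions, and to the orthogonal terms
`X m (p - s)`; the latter give that `X` has average `H_k` (`ae_tendsto_average_queueLen`). For a
general functional of the queues of at most linear growth, the queues are compared with
those that start empty `L` phases earlier (`exists_tendsto_average`). These are shorter, and the
average difference is `H_k - E[X L]`, which vanishes as `L` tends to infinity; so the error is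
controlled without an analysis of the stationary law.

Each bit that `k` transmits successfully is delivered or still pending, and there are `o(n)` pending
bits; therefore, every node delivers `p` bits per phase. With `T` the mean duration of a phase, the
throughput is `p / T`, and the bit-cost is `(τ / p) (H_k + 1) u_k` times the transmit power, because
`k` transmits with probability `τ` independently of its queue. Finally,
`p V + σ ≤ T ≤ τ V + σ` (`exists_tendsto_elapsedTime_div`): the longest packet is at least the
packet of a sole transmitter and at most the sum of all transmitted packets. For `τ = c √σ`, both
`τ / p → 1` and `σ / p → 0` as `σ → 0`, so `T / p → V`.
-/

/-! ### Averages of real sequences -/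

lemma tendsto_average_shift {x : ℕ → ℝ} (L : ℕ) {l : ℝ}
    (h : Tendsto (fun n : ℕ => (∑ m ∈ Finset.range n, x m) / n) atTop (𝓝 l)) :
    Tendsto (fun n : ℕ => (∑ m ∈ Finset.range n, x (m + L)) / n) atTop (𝓝 l) := by
  have h1 : Tendsto (fun n : ℕ => (n : ℝ) / (n + L : ℝ)) atTop (𝓝 1) :=
    tendsto_natCast_div_add_atTop (L : ℝ)
  have h2 : Tendsto (fun n : ℕ => (∑ m ∈ Finset.range L, x m) / (n : ℝ)) atTop (𝓝 0) :=
    tendsto_const_div_atTop_nhds_zero_nat _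
  have h3 := ((tendsto_add_atTop_iff_nat L).2 h |>.div h1 one_ne_zero).sub h2
  rw [sub_zero, div_one] at h3
  refine h3.congr' ?_
  filter_upwards [eventually_gt_atTop 0] with n hn
  have hn' : (0 : ℝ) < n := by exact_mod_cast hn
  have hnL : (0 : ℝ) < n + L := by positivity
  simp only [Pi.div_apply]
  rw [add_comm n L, Finset.sum_range_add]
  simp only [add_comm L]
  push_cast
  field_simp
  ring

/-- Finitely many terms do not affect asymptotic bounds on averages. -/
lemma eventually_abs_average_sub_le_of_shift {x : ℕ → ℝ} (L : ℕ) {c r : ℝ}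
    (h : ∀ δ > 0, ∀ᶠ n : ℕ in atTop, |(∑ m ∈ Finset.range n, x (m + L)) / n - c| ≤ r + δ)
    {δ : ℝ} (hδ : 0 < δ) :
    ∀ᶠ n : ℕ in atTop, |(∑ m ∈ Finset.range n, x m) / n - c| ≤ r + δ := by
  set K := ∑ m ∈ Finset.range L, (x m - c) with hK
  have hev : ∀ᶠ n : ℕ in atTop,
      |(∑ m ∈ Finset.range (n + L), x m) / ((n + L : ℕ) : ℝ) - c| ≤ r + δ := by
    filter_upwards [h (δ / 2) (half_pos hδ), eventually_gt_atTop 0,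
      (tendsto_natCast_atTop_atTop (R := ℝ)).eventually_ge_atTop (|K| / (δ / 2))] with n hn hn0 hnK
    have hn' : (0 : ℝ) < n := by exact_mod_cast hn0
    have hnL : (0 : ℝ) < ((n + L : ℕ) : ℝ) := by push_cast; positivity
    have hr : 0 ≤ r + δ := by linarith [abs_nonneg ((∑ m ∈ Finset.range n, x (m + L)) / n - c)]
    rw [div_le_iff₀ (half_pos hδ)] at hnK
    have e1 : (∑ m ∈ Finset.range n, x (m + L)) / n - c
        = (∑ m ∈ Finset.range n, (x (m + L) - c)) / n := by
      rw [Finset.sum_sub_distrib, Finset.sum_const, Finset.card_range, nsmul_eq_mul]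
      field_simp
    have e2 : (∑ m ∈ Finset.range (n + L), x m) / ((n + L : ℕ) : ℝ) - c
        = (K + ∑ m ∈ Finset.range n, (x (m + L) - c)) / ((n + L : ℕ) : ℝ) := by
      have : ∑ m ∈ Finset.range (n + L), (x m - c) = K + ∑ m ∈ Finset.range n, (x (m + L) - c) := by
        rw [add_comm n L, Finset.sum_range_add]
        simp only [add_comm L, hK]
      rw [← this, Finset.sum_sub_distrib, Finset.sum_const, Finset.card_range, nsmul_eq_mul]
      field_simp
    rw [e1, abs_div, Nat.abs_cast, div_le_iff₀ hn'] at hn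
    rw [e2, abs_div, Nat.abs_cast, div_le_iff₀ hnL]
    refine (abs_add_le _ _).trans ?_
    push_cast
    have : 0 ≤ (r + δ) * L := by positivity
    nlinarith
  obtain ⟨N, hN⟩ := eventually_atTop.1 hev
  filter_upwards [eventually_ge_atTop (N + L)] with n hn
  have := hN (n - L) (by omega)
  rwa [Nat.sub_add_cancel (by omega)] at this

/-- A sequence `a` that is eventually within `ε L` of `e L` for every `L`, where `ε → 0`, converges,
and `e` has the same limit. -/
lemma exists_tendsto_of_approx {a e ε : ℕ → ℝ} (hε : Tendsto ε atTop (𝓝 0))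
    (h : ∀ L, ∀ δ > 0, ∀ᶠ n in atTop, |a n - e L| ≤ ε L + δ) :
    ∃ l, Tendsto e atTop (𝓝 l) ∧ Tendsto a atTop (𝓝 l) := by
  have hclose : ∀ δ > 0, ∃ L₀, ∀ L ≥ L₀, ∀ᶠ n in atTop, |a n - e L| < δ := by
    intro δ hδ
    obtain ⟨L₀, hL₀⟩ := eventually_atTop.1 (hε.eventually (gt_mem_nhds (half_pos hδ)))
    refine ⟨L₀, fun L hL => ?_⟩
    filter_upwards [h L (δ / 2) (half_pos hδ)] with n hn
    linarith [hL₀ L hL]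
  have hcau : CauchySeq e := by
    refine Metric.cauchySeq_iff.2 fun δ hδ => ?_
    obtain ⟨L₀, hL₀⟩ := hclose (δ / 2) (half_pos hδ)
    refine ⟨L₀, fun L hL L' hL' => ?_⟩
    obtain ⟨n, h1, h2⟩ := ((hL₀ L hL).and (hL₀ L' hL')).exists
    rw [Real.dist_eq]
    rw [abs_lt] at *
    constructor <;> linarith [h1.1, h1.2, h2.1, h2.2]
  obtain ⟨l, hl⟩ := cauchySeq_tendsto_of_complete hcau
  refine ⟨l, hl, Metric.tendsto_atTop'.2 fun δ hδ => ?_⟩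
  obtain ⟨L₀, hL₀⟩ := hclose (δ / 2) (half_pos hδ)
  obtain ⟨L, hL, hL'⟩ := ((Metric.tendsto_nhds.1 hl (δ / 2) (half_pos hδ)).and
    (eventually_ge_atTop L₀)).exists
  obtain ⟨N, hN⟩ := eventually_atTop.1 (hL₀ L hL')
  refine ⟨N, fun n hn => ?_⟩
  have := hN n hn.le
  rw [Real.dist_eq] at *
  rw [abs_lt] at *
  constructor <;> linarith [this.1, this.2, hL.1, hL.2]

/-! ### A law of large numbers for sequences that are uncorrelated beyond a fixed lag -/

section LawOfLargeNumbers

variable {Ω : Type*} [MeasurableSpace Ω] {μ : Measure Ω}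

/-- The sum of the squares has finite mean, so it is finite almost surely. -/
lemma ae_tendsto_zero_of_summable_integral_sq {W : ℕ → Ω → ℝ} {b : ℕ → ℝ}
    (hW : ∀ k, Integrable (fun ω => W k ω ^ 2) μ) (hb : Summable b)
    (hle : ∀ k, ∫ ω, W k ω ^ 2 ∂μ ≤ b k) :
    ∀ᵐ ω ∂μ, Tendsto (fun k => W k ω) atTop (𝓝 0) := by
  have hmeas : ∀ k, AEMeasurable (fun ω => ENNReal.ofReal (W k ω ^ 2)) μ :=
    fun k => (hW k).1.aemeasurable.ennreal_ofReal
  have hfin : ∫⁻ ω, ∑' k, ENNReal.ofReal (W k ω ^ 2) ∂μ ≠ ⊤ := by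
    rw [lintegral_tsum hmeas]
    refine ne_top_of_le_ne_top hb.tsum_ofReal_ne_top (ENNReal.tsum_le_tsum fun k => ?_)
    rw [← ofReal_integral_eq_lintegral_ofReal (hW k) (ae_of_all _ fun ω => sq_nonneg _)]
    exact ENNReal.ofReal_le_ofReal (hle k)
  filter_upwards [ae_lt_top' (AEMeasurable.tsum hmeas) hfin] with ω hω
  have h1 := ENNReal.tendsto_atTop_zero_of_tsum_ne_top hω.ne
  have h2 := (ENNReal.tendsto_toReal ENNReal.zero_ne_top).comp h1
  simp only [Function.comp_def, ENNReal.toReal_ofReal (sq_nonneg _), ENNReal.toReal_zero] at h2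
  have h3 := h2.sqrt
  simp only [Real.sqrt_sq_eq_abs, Real.sqrt_zero] at h3
  exact (tendsto_zero_iff_abs_tendsto_zero _).2 h3

variable {Z : ℕ → Ω → ℝ} {C : ℝ} {L : ℕ}

lemma integrable_mul_of_memLp_two (hZ : ∀ i, MemLp (Z i) 2 μ) (i j : ℕ) :
    Integrable (fun ω => Z i ω * Z j ω) μ :=
  (hZ i).integrable_mul (hZ j)

lemma integral_mul_le_of_sq_le (hZ : ∀ i, MemLp (Z i) 2 μ)
    (hC : ∀ i, ∫ ω, Z i ω ^ 2 ∂μ ≤ C) (i j : ℕ) : ∫ ω, Z i ω * Z j ω ∂μ ≤ C := by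
  have h : ∫ ω, Z i ω * Z j ω ∂μ ≤ ∫ ω, (Z i ω ^ 2 / 2 + Z j ω ^ 2 / 2) ∂μ := by
    refine integral_mono (integrable_mul_of_memLp_two hZ i j)
      (((hZ i).integrable_sq.div_const 2).add ((hZ j).integrable_sq.div_const 2)) fun ω => ?_
    simp only
    nlinarith [sq_nonneg (Z i ω - Z j ω)]
  rw [integral_add ((hZ i).integrable_sq.div_const 2) ((hZ j).integrable_sq.div_const 2),
    integral_div, integral_div] at h
  linarith [hC i, hC j]

/-- In a sequence that is uncorrelated beyond lag `L`, each term interacts with at most `2 * L + 1`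
terms, so that second moments of sums grow linearly. -/
lemma integral_sq_sum_le (hZ : ∀ i, MemLp (Z i) 2 μ) (hC0 : 0 ≤ C)
    (hC : ∀ i, ∫ ω, Z i ω ^ 2 ∂μ ≤ C)
    (huncorr : ∀ i j, i + L < j → ∫ ω, Z i ω * Z j ω ∂μ = 0) (s : Finset ℕ) :
    ∫ ω, (∑ i ∈ s, Z i ω) ^ 2 ∂μ ≤ s.card * ((2 * L + 1) * C) := by
  have hint : ∀ i j, Integrable (fun ω => Z i ω * Z j ω) μ := integrable_mul_of_memLp_two hZ
  have hexp : ∀ ω, (∑ i ∈ s, Z i ω) ^ 2 = ∑ i ∈ s, ∑ j ∈ s, Z i ω * Z j ω := fun ω => by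
    rw [sq, Finset.sum_mul_sum]
  simp_rw [hexp]
  rw [integral_finsetSum _ fun i _ => integrable_finsetSum _ fun j _ => hint i j]
  rw [← nsmul_eq_mul]
  refine Finset.sum_le_card_nsmul _ _ _ fun i _ => ?_
  rw [integral_finsetSum _ fun j _ => hint i j]
  have hsub : ∑ j ∈ s, ∫ ω, Z i ω * Z j ω ∂μ ≤
      ∑ j ∈ s.filter (· ∈ Finset.Icc (i - L) (i + L)), C := by
    rw [Finset.sum_filter]
    refine Finset.sum_le_sum fun j _ => ?_
    split_ifs with hj
    · exact integral_mul_le_of_sq_le hZ hC i j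
    · rw [Finset.mem_Icc, not_and_or, not_le, not_le] at hj
      rcases hj with hj | hj
      · simp_rw [mul_comm (Z i _)]
        exact (huncorr j i (by omega)).le
      · exact (huncorr i j hj).le
  refine hsub.trans ?_
  rw [Finset.sum_const, nsmul_eq_mul]
  refine mul_le_mul_of_nonneg_right ?_ hC0
  have h1 : (s.filter (· ∈ Finset.Icc (i - L) (i + L))).card ≤ (Finset.Icc (i - L) (i + L)).card :=
    Finset.card_le_card fun j hj => (Finset.mem_filter.1 hj).2
  rw [Nat.card_Icc] at h1
  have h2 : (s.filter (· ∈ Finset.Icc (i - L) (i + L))).card ≤ 2 * L + 1 := by omega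
  exact_mod_cast h2

lemma summable_const_div_succ_sq (A : ℝ) : Summable fun k : ℕ => A / ((k : ℝ) + 1) ^ 2 := by
  have h := (summable_nat_add_iff 1).2 (Real.summable_one_div_nat_pow.2 one_lt_two)
  refine (h.mul_left A).congr fun k => ?_
  push_cast
  ring

/-- Averages along the squares converge by Borel–Cantelli, because the variance of a sum grows at
most linearly in the number of terms. Between `K ^ 2` and `(K + 1) ^ 2`, the sum of the
absolute values of the terms is negligible for the same reason. -/
lemma ae_tendsto_average_of_uncorrelated (hZ : ∀ i, MemLp (Z i) 2 μ) (hC0 : 0 ≤ C)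
    (hC : ∀ i, ∫ ω, Z i ω ^ 2 ∂μ ≤ C)
    (huncorr : ∀ i j, i + L < j → ∫ ω, Z i ω * Z j ω ∂μ = 0) :
    ∀ᵐ ω ∂μ, Tendsto (fun n : ℕ => (∑ i ∈ Finset.range n, Z i ω) / n) atTop (𝓝 0) := by
  -- `k + 1` instead of `k` avoids division by zero
  have hA : ∀ᵐ ω ∂μ, Tendsto
      (fun k : ℕ => (∑ i ∈ Finset.range ((k + 1) ^ 2), Z i ω) / ((k : ℝ) + 1) ^ 2) atTop (𝓝 0) := by
    refine ae_tendsto_zero_of_summable_integral_sq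
      (b := fun k => ((2 * L + 1) * C) / ((k : ℝ) + 1) ^ 2) (fun k => ?_)
      (summable_const_div_succ_sq _) fun k => ?_
    · exact ((memLp_finsetSum (Finset.range ((k + 1) ^ 2)) fun i _ => hZ i).integrable_sq.div_const
        ((((k : ℝ) + 1) ^ 2) ^ 2)).congr (ae_of_all _ fun ω => by simp [div_pow])
    · simp_rw [div_pow]
      rw [integral_div]
      have h := integral_sq_sum_le hZ hC0 hC huncorr (Finset.range ((k + 1) ^ 2))
      rw [Finset.card_range] at h
      push_cast at h
      have hk : (0 : ℝ) < k + 1 := by positivity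
      rw [div_le_div_iff₀ (by positivity) (by positivity)]
      calc _ ≤ ((k + 1 : ℝ) ^ 2 * ((2 * L + 1) * C)) * (k + 1) ^ 2 := by gcongr
        _ = _ := by ring
  have hB : ∀ᵐ ω ∂μ, Tendsto
      (fun k : ℕ => (∑ i ∈ Finset.Ico ((k + 1) ^ 2) ((k + 2) ^ 2), |Z i ω|) / ((k : ℝ) + 1) ^ 2)
      atTop (𝓝 0) := by
    refine ae_tendsto_zero_of_summable_integral_sq (b := fun k => (9 * C) / ((k : ℝ) + 1) ^ 2)
      (fun k => ?_) (summable_const_div_succ_sq _) fun k => ?_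
    · exact ((memLp_finsetSum (Finset.Ico ((k + 1) ^ 2) ((k + 2) ^ 2))
        fun i _ => (hZ i).abs).integrable_sq.div_const
        ((((k : ℝ) + 1) ^ 2) ^ 2)).congr (ae_of_all _ fun ω => by simp [div_pow])
    · simp_rw [div_pow]
      rw [integral_div]
      have hcard : (Finset.Ico ((k + 1) ^ 2) ((k + 2) ^ 2)).card = 2 * k + 3 := by
        rw [Nat.card_Ico, show (k + 2) ^ 2 = (k + 1) ^ 2 + (2 * k + 3) by ring]
        omega
      have h : ∫ ω, (∑ i ∈ Finset.Ico ((k + 1) ^ 2) ((k + 2) ^ 2), |Z i ω|) ^ 2 ∂μ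
          ≤ (2 * k + 3) * ((2 * k + 3) * C) := by
        calc _ ≤ ∫ ω, (2 * k + 3) * ∑ i ∈ Finset.Ico ((k + 1) ^ 2) ((k + 2) ^ 2), Z i ω ^ 2 ∂μ := by
              refine integral_mono_of_nonneg (ae_of_all _ fun ω => sq_nonneg _)
                ((integrable_finsetSum _ fun i _ => (hZ i).integrable_sq).const_mul _)
                (ae_of_all _ fun ω => ?_)
              have := sq_sum_le_card_mul_sum_sq (s := Finset.Ico ((k + 1) ^ 2) ((k + 2) ^ 2))
                (f := fun i => |Z i ω|)
              rw [hcard] at this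
              simpa using this
          _ ≤ _ := by
              rw [integral_const_mul, integral_finsetSum _ fun i _ => (hZ i).integrable_sq]
              refine mul_le_mul_of_nonneg_left ?_ (by positivity)
              refine (Finset.sum_le_card_nsmul _ _ C fun i _ => hC i).trans ?_
              rw [hcard, nsmul_eq_mul]
              push_cast
              rfl
      rw [div_le_div_iff₀ (by positivity) (by positivity)]
      have h9 : ((2 * k + 3 : ℝ)) ^ 2 ≤ 9 * (k + 1) ^ 2 := by nlinarith [Nat.cast_nonneg (α := ℝ) k]
      calc _ ≤ ((2 * k + 3 : ℝ) * ((2 * k + 3) * C)) * (k + 1) ^ 2 := by gcongr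
        _ = ((2 * k + 3 : ℝ) ^ 2) * (C * (k + 1) ^ 2) := by ring
        _ ≤ (9 * (k + 1) ^ 2) * (C * (k + 1) ^ 2) := by gcongr
        _ = _ := by ring
  filter_upwards [hA, hB] with ω hAω hBω
  have hAB := (hAω.abs.add hBω)
  rw [abs_zero, add_zero] at hAB
  -- `k = n.sqrt - 1` is the index with `(k + 1) ^ 2 ≤ n < (k + 2) ^ 2`
  have hK : Tendsto (fun n : ℕ => n.sqrt - 1) atTop atTop := by
    refine tendsto_atTop.2 fun b => ?_
    filter_upwards [eventually_ge_atTop ((b + 1) * (b + 1))] with n hn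
    have := Nat.le_sqrt.2 hn
    omega
  refine squeeze_zero_norm' ?_ (hAB.comp hK)
  filter_upwards [eventually_ge_atTop 1] with n hn
  obtain ⟨k, hk⟩ : ∃ k, n.sqrt = k + 1 := ⟨n.sqrt - 1, by have := Nat.sqrt_pos.2 hn; omega⟩
  have hlo : (k + 1) ^ 2 ≤ n := by rw [← hk]; exact Nat.sqrt_le' n
  have hhi : n < (k + 2) ^ 2 := by
    have := Nat.lt_succ_sqrt' n
    rwa [hk] at this
  simp only [Function.comp_apply, hk, Nat.add_sub_cancel, Real.norm_eq_abs]
  rw [← Finset.sum_range_add_sum_Ico _ hlo, abs_div, Nat.abs_cast, abs_div,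
    abs_of_nonneg (by positivity : (0 : ℝ) ≤ ((k : ℝ) + 1) ^ 2), ← add_div]
  have hlo' : ((k : ℝ) + 1) ^ 2 ≤ n := by exact_mod_cast hlo
  refine div_le_div₀ (add_nonneg (abs_nonneg _) (Finset.sum_nonneg fun _ _ => abs_nonneg _)) ?_
    (by positivity) hlo'
  refine (abs_add_le _ _).trans (add_le_add le_rfl ?_)
  refine (Finset.abs_sum_le_sum_abs _ _).trans ?_
  exact Finset.sum_le_sum_of_subset_of_nonneg (Finset.Ico_subset_Ico_right hhi.le)
    fun _ _ _ => abs_nonneg _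

end LawOfLargeNumbers

lemma MeasureTheory.MeasurePreserving.integral_comp_of_aestronglyMeasurable {X Y : Type*}
    [MeasurableSpace X] [MeasurableSpace Y] {μ : Measure X} {ν : Measure Y} {f : X → Y}
    (h : MeasurePreserving f μ ν) {g : Y → ℝ} (hg : AEStronglyMeasurable g ν) :
    ∫ x, g (f x) ∂μ = ∫ y, g y ∂ν := by
  obtain ⟨hf, rfl⟩ := h
  exact (integral_map hf.aemeasurable hg).symm

/-! ### Functionals of finitely many coordinates of an i.i.d. sequence -/

section FiniteWindows

open Measure

variable {α : Type*} {f g : (ℕ → α) → ℝ} {s t : Finset ℕ}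

lemma DependsOn.exists_restrict [Nonempty α] (hf : DependsOn f (s : Set ℕ)) :
    ∃ F : (s → α) → ℝ, f = fun ω => F fun i => ω i := by
  obtain ⟨a⟩ := ‹Nonempty α›
  classical
  refine ⟨fun x => f fun i => if h : i ∈ s then x ⟨i, h⟩ else a, funext fun ω => hf ?_⟩
  intro i hi
  simp [Finset.mem_coe.1 hi]

/-- The sequence `ω` from time `m` on. -/
def shiftSeq (m : ℕ) (ω : ℕ → α) : ℕ → α := fun n => ω (m + n)

lemma DependsOn.comp_shiftSeq {L : ℕ} (hf : DependsOn f (Finset.range L : Set ℕ)) (m : ℕ) :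
    DependsOn (fun ω => f (shiftSeq m ω)) (Finset.Ico m (m + L) : Set ℕ) := by
  intro x y h
  refine hf fun i hi => h _ ?_
  simp only [Finset.coe_range, Set.mem_Iio, Finset.coe_Ico, Set.mem_Ico] at hi ⊢
  omega

variable [MeasurableSpace α] {ν : Measure α} [IsProbabilityMeasure ν]

lemma measurePreserving_shiftSeq (m : ℕ) :
    MeasurePreserving (shiftSeq m) (infinitePi fun _ : ℕ => ν) (infinitePi fun _ : ℕ => ν) := by
  refine ⟨by unfold shiftSeq; fun_prop, ?_⟩
  exact map_infinitePi_infinitePi_of_inj (P := fun _ : ℕ => ν) (add_right_injective m)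

lemma integral_comp_shiftSeq (hf : AEStronglyMeasurable f (infinitePi fun _ : ℕ => ν)) (m : ℕ) :
    ∫ ω, f (shiftSeq m ω) ∂(infinitePi fun _ : ℕ => ν) = ∫ ω, f ω ∂(infinitePi fun _ : ℕ => ν) :=
  (measurePreserving_shiftSeq m).integral_comp_of_aestronglyMeasurable hf

variable [Finite α] [MeasurableSingletonClass α]

lemma DependsOn.measurable_of_finite [Nonempty α] (hf : DependsOn f (s : Set ℕ)) :
    Measurable f := by
  obtain ⟨F, rfl⟩ := hf.exists_restrict
  exact (_root_.measurable_of_finite F).comp (by fun_prop)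

lemma DependsOn.memLp (hf : DependsOn f (s : Set ℕ)) (p : ENNReal) :
    MemLp f p (infinitePi fun _ : ℕ => ν) := by
  have := nonempty_of_isProbabilityMeasure ν
  have hm := hf.measurable_of_finite
  obtain ⟨F, rfl⟩ := hf.exists_restrict
  obtain ⟨C, hC⟩ := (Set.finite_range fun x => ‖F x‖).bddAbove
  exact MemLp.of_bound hm.aestronglyMeasurable C (ae_of_all _ fun ω => hC ⟨_, rfl⟩)

lemma DependsOn.integrable (hf : DependsOn f (s : Set ℕ)) :
    Integrable f (infinitePi fun _ : ℕ => ν) :=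
  memLp_one_iff_integrable.1 (hf.memLp 1)

/-- Functionals of disjoint sets of coordinates are independent. -/
lemma DependsOn.integral_mul (hf : DependsOn f (s : Set ℕ)) (hg : DependsOn g (t : Set ℕ))
    (hst : Disjoint s t) :
    ∫ ω, f ω * g ω ∂(infinitePi fun _ : ℕ => ν) =
      (∫ ω, f ω ∂(infinitePi fun _ : ℕ => ν)) * ∫ ω, g ω ∂(infinitePi fun _ : ℕ => ν) := by
  have := nonempty_of_isProbabilityMeasure ν
  have hfm := hf.measurable_of_finite
  have hgm := hg.measurable_of_finite
  obtain ⟨F, rfl⟩ := hf.exists_restrict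
  obtain ⟨G, rfl⟩ := hg.exists_restrict
  have hind : iIndepFun (fun (i : ℕ) (ω : ℕ → α) => ω i) (infinitePi fun _ : ℕ => ν) :=
    iIndepFun_infinitePi (P := fun _ : ℕ => ν) (X := fun _ x => x) fun _ => measurable_id
  have h := (hind.indepFun_finset s t hst fun i => by fun_prop).comp
    (_root_.measurable_of_finite F) (_root_.measurable_of_finite G)
  exact h.integral_fun_mul_eq_mul_integral hfm.aestronglyMeasurable hgm.aestronglyMeasurable

/-- Birkhoff averages of a functional of finitely many coordinates converge to its mean. -/
lemma ae_tendsto_average_window {L : ℕ} (hf : DependsOn f (Finset.range L : Set ℕ)) :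
    ∀ᵐ ω ∂(infinitePi fun _ : ℕ => ν), Tendsto
      (fun n : ℕ => (∑ m ∈ Finset.range n, f (shiftSeq m ω)) / n) atTop
      (𝓝 (∫ ω, f ω ∂(infinitePi fun _ : ℕ => ν))) := by
  set e := ∫ ω, f ω ∂(infinitePi fun _ : ℕ => ν) with he
  set h : (ℕ → α) → ℝ := fun ω => f ω - e with hh
  have hdep : DependsOn h (Finset.range L : Set ℕ) := fun x y hxy => by
    simp only [hh, hf hxy]
  have h0 : ∫ ω, h ω ∂(infinitePi fun _ : ℕ => ν) = 0 := by
    rw [hh, integral_sub (hf.integrable) (integrable_const _)]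
    simp [he]
  have hsq : DependsOn (fun ω => h ω ^ 2) (Finset.range L : Set ℕ) := fun x y hxy => by
    simp only [hdep hxy]
  have hmean : ∀ m, ∫ ω, h (shiftSeq m ω) ∂(infinitePi fun _ : ℕ => ν) = 0 := fun m => by
    rw [integral_comp_shiftSeq hdep.integrable.1, h0]
  have key := ae_tendsto_average_of_uncorrelated (μ := infinitePi fun _ : ℕ => ν)
    (Z := fun m ω => h (shiftSeq m ω)) (C := ∫ ω, h ω ^ 2 ∂(infinitePi fun _ : ℕ => ν)) (L := L)
    (fun m => (hdep.comp_shiftSeq m).memLp 2) (integral_nonneg fun _ => sq_nonneg _)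
    (fun m => (integral_comp_shiftSeq hsq.integrable.1 m).le)
    (fun i j hij => by
      rw [(hdep.comp_shiftSeq i).integral_mul (hdep.comp_shiftSeq j), hmean, zero_mul]
      rw [Finset.disjoint_left]
      intro a ha hb
      rw [Finset.mem_Ico] at ha hb
      omega)
  filter_upwards [key] with ω hω
  have := hω.add_const e
  rw [zero_add] at this
  refine this.congr' ?_
  filter_upwards [eventually_gt_atTop 0] with n hn
  have hn' : (0 : ℝ) < n := by exact_mod_cast hn
  simp only [hh, Finset.sum_sub_distrib, Finset.sum_const, Finset.card_range, nsmul_eq_mul]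
  field_simp
  ring

end FiniteWindows

namespace RelayNetwork

variable {ι : Type*} [Fintype ι] [DecidableEq ι]

/-! ### Dynamics of the forwarding queues without limits on pending and forwarded packets -/

lemma soleTransmitter_eq_some_iff {a : ι → Bool} {k : ι} :
    soleTransmitter a = some k ↔ transmitters a = {k} := by
  unfold soleTransmitter
  split_ifs with h
  · rw [Option.some_inj]
    have hc := h.choose_spec
    constructor
    · rintro rfl
      exact hc
    · intro hk
      exact Finset.singleton_injective (hc.symm.trans hk)
  · simp only [false_iff]
    exact fun hk => h ⟨k, hk⟩

/-- Indicator of the event that node `k` transmits successfully. -/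
noncomputable def successInd (k : ι) (a : ι → Bool) : ℝ :=
  if soleTransmitter a = some k then 1 else 0

lemma successInd_nonneg (k : ι) (a : ι → Bool) : 0 ≤ successInd k a := by
  unfold successInd; split_ifs <;> norm_num

lemma successInd_le_one (k : ι) (a : ι → Bool) : successInd k a ≤ 1 := by
  unfold successInd; split_ifs <;> norm_num

lemma successInd_sq (k : ι) (a : ι → Bool) : successInd k a ^ 2 = successInd k a := by
  unfold successInd; split_ifs <;> norm_num

lemma successInd_mul_of_ne {j k : ι} (h : j ≠ k) (a : ι → Bool) :
    successInd j a * successInd k a = 0 := by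
  unfold successInd
  split_ifs with h1 h2 <;> simp
  exact h (Option.some_inj.1 (h1.symm.trans h2))

variable (net : RelayNetwork ι)

@[simp] lemma nextHop_top {ι : Type*} [DecidableEq ι] (net : RelayNetwork ι)
    (q : ι → List ι) (k : ι) : net.nextHop ⊤ q k = net.helper k := by
  simp [nextHop]

@[simp] lemma jointPart_top {ι : Type*} (q : ι → List ι) (k : ι) : jointPart ⊤ q k = q k := by
  simp [jointPart]

/-- Indicator of the event that a packet arrives at the forwarding queue of `k`. -/
noncomputable def arrivalInd (k : ι) (a : ι → Bool) : ℝ :=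
  ∑ j with net.helper j = some k, successInd j a

/-- Length `X_k` of the forwarding queue of `k` just before phase `n`. -/
noncomputable def queueLen (n : ℕ) (k : ι) (ω : ℕ → ι → Bool) : ℝ :=
  ((net.queues ⊤ ⊤ ω n k).length : ℝ)

lemma queueLen_nonneg (n : ℕ) (k : ι) (ω : ℕ → ι → Bool) : 0 ≤ net.queueLen n k ω :=
  Nat.cast_nonneg _

/-- At most one node transmits successfully, so `arrivalInd` takes the values zero and one only. -/
lemma arrivalInd_sq (k : ι) (a : ι → Bool) : net.arrivalInd k a ^ 2 = net.arrivalInd k a := by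
  unfold arrivalInd
  rw [sq, Finset.sum_mul_sum]
  refine Finset.sum_congr rfl fun i hi => ?_
  rw [Finset.sum_eq_single_of_mem i hi fun j _ hj => successInd_mul_of_ne hj.symm a, ← sq,
    successInd_sq]

lemma queues_congr {n : ℕ} {ω ω' : ℕ → ι → Bool} (h : ∀ m < n, ω m = ω' m) :
    net.queues ⊤ ⊤ ω n = net.queues ⊤ ⊤ ω' n := by
  induction n with
  | zero => rfl
  | succ n ih =>
    rw [queues, queues, ih fun m hm => h m (hm.trans n.lt_succ_self), h n n.lt_succ_self]

variable {net}

lemma helper_ne_self {ι : Type*} {net : RelayNetwork ι}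
    (hdirect : ∀ k h, net.helper k = some h → net.helper h = none)
    (k : ι) : net.helper k ≠ some k := fun h => by
  have := hdirect k k h
  simp [h] at this

/-- No node is its own helper, so a queue is never emptied and filled in the same phase. -/
lemma successInd_mul_arrivalInd (hdirect : ∀ k h, net.helper k = some h → net.helper h = none)
    (k : ι) (a : ι → Bool) :
    successInd k a * net.arrivalInd k a = 0 := by
  unfold arrivalInd
  rw [Finset.mul_sum]
  refine Finset.sum_eq_zero fun j hj => successInd_mul_of_ne ?_ a
  rintro rfl
  exact helper_ne_self hdirect _ (Finset.mem_filter.1 hj).2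

lemma helper_of_mem_nextQueues {q : ι → List ι}
    (hq : ∀ k, ∀ j ∈ q k, net.helper j = some k) (a : ι → Bool) :
    ∀ k, ∀ j ∈ net.nextQueues ⊤ ⊤ q a k, net.helper j = some k := by
  intro k j hj
  unfold nextQueues at hj
  rcases hs : soleTransmitter a with _ | i
  · simp only [hs] at hj
    exact hq k j hj
  · rcases hh : net.helper i with _ | h
    · simp only [hs, nextHop_top, hh, jointPart_top, List.drop_length, Function.update_apply] at hj
      split_ifs at hj with hk
      · simp at hj
      · exact hq k j hj
    · simp only [hs, nextHop_top, hh, Function.update_apply] at hj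
      split_ifs at hj with hk
      · subst hk
        rcases List.mem_append.1 hj with hj | hj
        · exact hq k j hj
        · rw [List.mem_singleton.1 hj, hh]
      · exact hq k j hj

lemma helper_of_mem_queues (ω : ℕ → ι → Bool) (n : ℕ) :
    ∀ k, ∀ j ∈ net.queues ⊤ ⊤ ω n k, net.helper j = some k := by
  induction n with
  | zero => intro k j hj; simp [queues] at hj
  | succ n ih => exact helper_of_mem_nextQueues ih (ω n)

lemma queues_eq_nil_of_helper (hdirect : ∀ k h, net.helper k = some h → net.helper h = none)
    {k h : ι} (hk : net.helper k = some h) (ω : ℕ → ι → Bool) (n : ℕ) :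
    net.queues ⊤ ⊤ ω n k = [] := by
  refine List.eq_nil_iff_forall_not_mem.2 fun j hj => ?_
  have := hdirect j k (helper_of_mem_queues ω n k j hj)
  simp [hk] at this

/-- The recursion also holds for a node that has a helper: its own queue is always empty. -/
lemma queueLen_succ (hdirect : ∀ k h, net.helper k = some h → net.helper h = none)
    (n : ℕ) (k : ι) (ω : ℕ → ι → Bool) :
    net.queueLen (n + 1) k ω =
      (1 - successInd k (ω n)) * net.queueLen n k ω + net.arrivalInd k (ω n) := by
  have harr : ∀ i, soleTransmitter (ω n) = some i →
      net.arrivalInd k (ω n) = if net.helper i = some k then 1 else 0 := by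
    intro i hi
    unfold arrivalInd successInd
    simp [hi, Finset.sum_ite_eq]
  unfold queueLen
  rw [queues, nextQueues]
  rcases hs : soleTransmitter (ω n) with _ | i
  · simp [arrivalInd, successInd, hs]
  rw [harr i hs]
  rcases hh : net.helper i with _ | h
  · simp only [nextHop_top, hh, jointPart_top, List.drop_length, Function.update_apply, successInd,
      hs, Option.some_inj]
    by_cases hk : k = i
    · simp [hk]
    · simp [hk, Ne.symm hk]
  · simp only [nextHop_top, hh, Function.update_apply, successInd, hs, Option.some_inj]
    by_cases hk : k = h
    · subst hk
      have : i ≠ k := by rintro rfl; exact helper_ne_self hdirect _ hh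
      simp [this]
    · by_cases hik : i = k
      · subst hik
        simp [queues_eq_nil_of_helper hdirect hh, Ne.symm hk, hk]
      · simp [hik, hk, Ne.symm hk]

/-- Starting from empty queues at time `m` instead of time `0` can only shorten the queues. -/
lemma queueLen_shiftSeq_le (hdirect : ∀ k h, net.helper k = some h → net.helper h = none)
    (m L : ℕ) (k : ι) (ω : ℕ → ι → Bool) :
    net.queueLen L k (shiftSeq m ω) ≤ net.queueLen (m + L) k ω := by
  induction L with
  | zero => simp [queueLen, queues]
  | succ L ih =>
    rw [queueLen_succ hdirect, ← add_assoc, queueLen_succ hdirect]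
    have h1 := sub_nonneg.2 (successInd_le_one k (ω (m + L)))
    exact add_le_add (mul_le_mul_of_nonneg_left ih h1) le_rfl

lemma phaseBits_add_pending {q : ι → List ι} (hq : ∀ k, ∀ j ∈ q k, net.helper j = some k)
    (k : ι) (a : ι → Bool) :
    net.phaseBits ⊤ ⊤ k q a + net.pending (net.nextQueues ⊤ ⊤ q a) k =
      net.pending q k + if soleTransmitter a = some k then 1 else 0 := by
  have hcount : ∀ j, net.helper k ≠ some j → (q j).count k = 0 := fun j hj =>
    List.count_eq_zero.2 fun hk => hj (hq j k hk)
  unfold phaseBits nextQueues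
  rcases hs : soleTransmitter a with _ | i
  · simp
  rcases hh : net.helper i with _ | h
  · simp only [nextHop_top, hh, jointPart_top, List.drop_length, pending, Option.some_inj]
    rcases hk : net.helper k with _ | h'
    · simp [hcount i (by simp [hk])]
    · have hik : i ≠ k := by rintro rfl; simp [hh] at hk
      simp only [hik, if_false, Function.update_apply]
      split_ifs with hi
      · subst hi; simp
      · simp [hcount i (by rw [hk]; simpa using hi)]
  · simp only [nextHop_top, hh, pending, Option.some_inj]
    rcases hk : net.helper k with _ | h'
    · have hik : i ≠ k := by rintro rfl; simp [hh] at hk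
      simp [hik]
    · simp only [Function.update_apply]
      split_ifs with h1 h2 h2
      · subst h1; subst h2; simp
      · subst h1; simp [h2]
      · subst h2; rw [hh] at hk; exact absurd (Option.some_inj.1 hk).symm h1
      · simp

/-- Every bit of `k` that was transmitted successfully by `k` has either reached the AP or is still
pending. -/
lemma deliveredBits_add_pending (k : ι) (n : ℕ) (ω : ℕ → ι → Bool) :
    (net.deliveredBits ⊤ ⊤ k n ω : ℝ) + net.pending (net.queues ⊤ ⊤ ω n) k =
      ∑ m ∈ Finset.range n, successInd k (ω m) := by
  induction n with
  | zero =>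
    simp only [deliveredBits, queues, pending, Finset.range_zero, Finset.sum_empty, Nat.cast_zero]
    split <;> simp
  | succ n ih =>
    rw [Finset.sum_range_succ, ← ih, deliveredBits, Finset.sum_range_succ, ← deliveredBits, queues]
    have h := phaseBits_add_pending (helper_of_mem_queues (net := net) ω n) k (ω n)
    have h' : ((net.phaseBits ⊤ ⊤ k (net.queues ⊤ ⊤ ω n) (ω n) : ℕ) : ℝ) +
        net.pending (net.nextQueues ⊤ ⊤ (net.queues ⊤ ⊤ ω n) (ω n)) k =
        net.pending (net.queues ⊤ ⊤ ω n) k + successInd k (ω n) := by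
      unfold successInd
      exact_mod_cast h
    push_cast
    linarith

lemma pending_le_sum_queueLen (k : ι) (n : ℕ) (ω : ℕ → ι → Bool) :
    (net.pending (net.queues ⊤ ⊤ ω n) k : ℝ) ≤ ∑ h, net.queueLen n h ω := by
  unfold pending
  rcases net.helper k with _ | h
  · simpa using Finset.sum_nonneg fun h _ => net.queueLen_nonneg n h ω
  · refine le_trans ?_ (Finset.single_le_sum (fun h _ => net.queueLen_nonneg n h ω)
      (Finset.mem_univ h))
    exact Nat.cast_le.2 List.count_le_length

/-! ### Means with respect to the access law -/

variable (τ : unitInterval)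

instance : IsProbabilityMeasure (accessLaw ι τ) := by unfold accessLaw; infer_instance

lemma integral_accessLaw_eval {ι : Type*} [Fintype ι] (g : (ι → Bool) → ℝ) (m : ℕ) :
    ∫ ω, g (ω m) ∂(accessLaw ι τ) =
      ∫ a, g a ∂(Measure.infinitePi fun _ : ι => bernoulliMeasure true false τ) := by
  exact (measurePreserving_eval_infinitePi
    (fun _ : ℕ => Measure.infinitePi fun _ : ι => bernoulliMeasure true false τ)
    m).integral_comp_of_aestronglyMeasurable (measurable_of_finite g).aestronglyMeasurable

lemma integral_transmit {ι : Type*} (k : ι) :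
    ∫ a, (if a k = true then (1 : ℝ) else 0)
      ∂(Measure.infinitePi fun _ : ι => bernoulliMeasure true false τ) = τ := by
  refine ((measurePreserving_eval_infinitePi (fun _ : ι => bernoulliMeasure true false τ)
    k).integral_comp_of_aestronglyMeasurable (g := fun b : Bool => if b = true then (1 : ℝ) else 0)
    (measurable_of_finite _).aestronglyMeasurable).trans ?_
  rw [integral_bernoulliMeasure]
  simp

lemma integral_successInd (k : ι) :
    ∫ a, successInd k a ∂(Measure.infinitePi fun _ : ι => bernoulliMeasure true false τ) =
      successProb ι τ := by
  have hset : {a : ι → Bool | soleTransmitter a = some k} = {fun j => decide (j = k)} := by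
    ext a
    rw [Set.mem_ofPred_eq, soleTransmitter_eq_some_iff, Set.mem_singleton_iff, Finset.ext_iff,
      funext_iff]
    refine forall_congr' fun j => ?_
    by_cases hj : j = k <;> cases h : a j <;> simp [transmitters, hj, h] <;> simp_all
  have hind : successInd k = Set.indicator {a : ι → Bool | soleTransmitter a = some k} 1 := by
    ext a
    simp [successInd, Set.indicator_apply]
  rw [hind, integral_indicator_one (Set.toFinite _).measurableSet, hset, measureReal_def,
    Measure.infinitePi_singleton_of_fintype]
  rw [← Finset.mul_prod_erase _ _ (Finset.mem_univ k)]
  rw [Finset.prod_congr rfl (g := fun _ => bernoulliMeasure true false τ {false}) fun j hj => by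
    simp [Finset.ne_of_mem_erase hj]]
  rw [Finset.prod_const, Finset.card_erase_of_mem (Finset.mem_univ k), Finset.card_univ]
  simp [successProb]

/-! ### Mean queue lengths -/

lemma successProb_nonneg {ι : Type*} [Fintype ι] (τ : unitInterval) : 0 ≤ successProb ι τ :=
  mul_nonneg τ.2.1 (pow_nonneg (sub_nonneg.2 τ.2.2) _)

lemma successProb_pos {ι : Type*} [Fintype ι] {τ : ℝ} (h0 : 0 < τ) (h1 : τ < 1) :
    0 < successProb ι τ :=
  mul_pos h0 (pow_pos (sub_pos.2 h1) _)

lemma successProb_le {ι : Type*} [Fintype ι] (τ : unitInterval) : successProb ι τ ≤ τ :=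
  mul_le_of_le_one_right τ.2.1
    (pow_le_one₀ (sub_nonneg.2 τ.2.2) (sub_le_self _ τ.2.1))

lemma dependsOn_eval {ι : Type*} (g : (ι → Bool) → ℝ) (m : ℕ) :
    DependsOn (fun ω : ℕ → ι → Bool => g (ω m)) (({m} : Finset ℕ) : Set ℕ) := by
  intro x y h
  simp only [h m (by simp)]

lemma dependsOn_queueLen (n : ℕ) (k : ι) :
    DependsOn (net.queueLen n k) (Finset.range n : Set ℕ) := by
  intro x y h
  unfold queueLen
  rw [queues_congr net fun m hm => h m (by simpa using hm)]

lemma integral_queueLen_pow_mul_eval (n r : ℕ) (k : ι) (g : (ι → Bool) → ℝ) :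
    ∫ ω, net.queueLen n k ω ^ r * g (ω n) ∂(accessLaw ι τ) =
      (∫ ω, net.queueLen n k ω ^ r ∂(accessLaw ι τ)) *
        ∫ a, g a ∂(Measure.infinitePi fun _ : ι => bernoulliMeasure true false τ) := by
  rw [← integral_accessLaw_eval τ g n]
  refine DependsOn.integral_mul (s := Finset.range n) (t := {n}) (fun x y h => ?_)
    (dependsOn_eval g n) (by simp)
  simp only [dependsOn_queueLen n k h]

lemma integrable_queueLen_pow_mul_eval (n r : ℕ) (k : ι) (g : (ι → Bool) → ℝ) :
    Integrable (fun ω => net.queueLen n k ω ^ r * g (ω n)) (accessLaw ι τ) := by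
  refine DependsOn.integrable (s := Finset.range (n + 1)) fun x y h => ?_
  rw [dependsOn_queueLen n k fun i hi => h i ?_, h n (by simp)]
  simp only [Finset.coe_range, Set.mem_Iio] at hi ⊢
  omega

lemma integral_arrivalInd (k : ι) :
    ∫ a, net.arrivalInd k a ∂(Measure.infinitePi fun _ : ι => bernoulliMeasure true false τ) =
      successProb ι τ * net.helpedCount k := by
  unfold arrivalInd
  rw [integral_finsetSum _ fun j _ => Integrable.of_finite]
  simp_rw [integral_successInd]
  rw [Finset.sum_const, nsmul_eq_mul, mul_comm]
  rfl

lemma integral_one_sub_successInd (k : ι) :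
    ∫ a, (1 - successInd k a) ∂(Measure.infinitePi fun _ : ι => bernoulliMeasure true false τ) =
      1 - successProb ι τ := by
  rw [integral_sub Integrable.of_finite Integrable.of_finite, integral_successInd]
  simp

lemma integral_queueLen_succ (hdirect : ∀ k h, net.helper k = some h → net.helper h = none)
    (n : ℕ) (k : ι) :
    ∫ ω, net.queueLen (n + 1) k ω ∂(accessLaw ι τ) =
      (1 - successProb ι τ) * (∫ ω, net.queueLen n k ω ∂(accessLaw ι τ)) +
        successProb ι τ * net.helpedCount k := by
  have h1 := integral_queueLen_pow_mul_eval (net := net) τ n 1 k fun a => 1 - successInd k a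
  have h2 := integral_queueLen_pow_mul_eval (net := net) τ n 0 k (net.arrivalInd k)
  have i1 := integrable_queueLen_pow_mul_eval (net := net) τ n 1 k fun a => 1 - successInd k a
  have i2 := integrable_queueLen_pow_mul_eval (net := net) τ n 0 k (net.arrivalInd k)
  rw [integral_one_sub_successInd] at h1
  rw [integral_arrivalInd] at h2
  simp only [pow_one, pow_zero, one_mul, integral_const, probReal_univ, smul_eq_mul, mul_one]
    at h1 h2 i1 i2
  rw [mul_comm (1 - _), ← h1, ← h2, ← integral_add i1 i2]
  refine integral_congr_ae (ae_of_all _ fun ω => ?_)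
  simp only [queueLen_succ hdirect n k ω]
  ring

lemma integral_queueLen (hdirect : ∀ k h, net.helper k = some h → net.helper h = none)
    (n : ℕ) (k : ι) :
    ∫ ω, net.queueLen n k ω ∂(accessLaw ι τ) =
      net.helpedCount k * (1 - (1 - successProb ι τ) ^ n) := by
  induction n with
  | zero => simp [queueLen, queues]
  | succ n ih =>
    rw [integral_queueLen_succ τ hdirect, ih]
    ring

lemma integral_queueLen_le (hdirect : ∀ k h, net.helper k = some h → net.helper h = none)
    (n : ℕ) (k : ι) : ∫ ω, net.queueLen n k ω ∂(accessLaw ι τ) ≤ net.helpedCount k := by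
  rw [integral_queueLen τ hdirect]
  have hp := (successProb_le (ι := ι) τ).trans τ.2.2
  exact mul_le_of_le_one_right (Nat.cast_nonneg _)
    (sub_le_self _ (pow_nonneg (sub_nonneg.2 hp) _))

lemma tendsto_integral_queueLen (hdirect : ∀ k h, net.helper k = some h → net.helper h = none)
    (h0 : 0 < (τ : ℝ)) (h1 : (τ : ℝ) < 1) (k : ι) :
    Tendsto (fun n => ∫ ω, net.queueLen n k ω ∂(accessLaw ι τ)) atTop
      (𝓝 (net.helpedCount k : ℝ)) := by
  simp_rw [integral_queueLen τ hdirect]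
  have hp := successProb_pos (ι := ι) h0 h1
  have hp1 := (successProb_le (ι := ι) τ).trans τ.2.2
  have := (tendsto_pow_atTop_nhds_zero_of_lt_one (r := 1 - successProb ι τ) (by linarith)
    (by linarith)).const_sub 1 |>.const_mul (net.helpedCount k : ℝ)
  simpa using this

/-- The bound `M = 2 H ^ 2 + H` is the fixed point of the recursion
`M = (1 - p) M + 2 p H ^ 2 + p H`, which dominates that of the second moments. -/
lemma integral_queueLen_sq_le (hdirect : ∀ k h, net.helper k = some h → net.helper h = none)
    (n : ℕ) (k : ι) : ∫ ω, net.queueLen n k ω ^ 2 ∂(accessLaw ι τ) ≤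
      2 * (net.helpedCount k : ℝ) ^ 2 + net.helpedCount k := by
  induction n with
  | zero => simp [queueLen, queues]; positivity
  | succ n ih =>
    have h1 := integral_queueLen_pow_mul_eval (net := net) τ n 2 k fun a => 1 - successInd k a
    have h2 := integral_queueLen_pow_mul_eval (net := net) τ n 1 k (net.arrivalInd k)
    have h3 := integral_queueLen_pow_mul_eval (net := net) τ n 0 k (net.arrivalInd k)
    have i1 := integrable_queueLen_pow_mul_eval (net := net) τ n 2 k fun a => 1 - successInd k a
    have i2 := integrable_queueLen_pow_mul_eval (net := net) τ n 1 k (net.arrivalInd k)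
    have i3 := integrable_queueLen_pow_mul_eval (net := net) τ n 0 k (net.arrivalInd k)
    rw [integral_one_sub_successInd] at h1
    rw [integral_arrivalInd] at h2 h3
    simp only [pow_one, pow_zero, one_mul, integral_const, probReal_univ, smul_eq_mul, mul_one]
      at h2 h3 i2 i3
    have key : ∫ ω, net.queueLen (n + 1) k ω ^ 2 ∂(accessLaw ι τ) =
        (∫ ω, net.queueLen n k ω ^ 2 ∂(accessLaw ι τ)) * (1 - successProb ι τ) +
        2 * ((∫ ω, net.queueLen n k ω ∂(accessLaw ι τ)) *
          (successProb ι τ * net.helpedCount k)) + successProb ι τ * net.helpedCount k := by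
      rw [← h1, ← h2, ← h3, ← integral_const_mul, ← integral_add i1 (i2.const_mul 2)]
      refine Eq.trans ?_ (integral_add (i1.add (i2.const_mul 2)) i3)
      refine integral_congr_ae (ae_of_all _ fun ω => ?_)
      -- both indicators are idempotent and their product vanishes
      have e1 := successInd_sq k (ω n)
      have e2 := net.arrivalInd_sq k (ω n)
      have e3 := successInd_mul_arrivalInd hdirect k (ω n)
      simp only [queueLen_succ hdirect n k ω]
      linear_combination (net.queueLen n k ω ^ 2) * e1 + e2 - 2 * net.queueLen n k ω * e3
    rw [key]
    have hp := successProb_nonneg (ι := ι) τ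
    have hp1 := (successProb_le (ι := ι) τ).trans τ.2.2
    have hm := integral_queueLen_le τ hdirect n k
    have hH : (0 : ℝ) ≤ net.helpedCount k := Nat.cast_nonneg _
    have g1 := mul_le_mul_of_nonneg_right ih (sub_nonneg.2 hp1)
    have g2 := mul_le_mul_of_nonneg_right hm (mul_nonneg hp hH)
    nlinarith

/-! ### Almost sure averages -/

lemma ae_tendsto_average_eval {ι : Type*} [Fintype ι] (τ : unitInterval)
    (g : (ι → Bool) → ℝ) :
    ∀ᵐ ω ∂(accessLaw ι τ), Tendsto
      (fun n : ℕ => (∑ m ∈ Finset.range n, g (ω m)) / n) atTop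
      (𝓝 (∫ a, g a ∂(Measure.infinitePi fun _ : ι => bernoulliMeasure true false τ))) := by
  rw [← integral_accessLaw_eval τ g 0]
  exact ae_tendsto_average_window (L := 1) (dependsOn_eval g 0)

lemma memLp_queueLen (n : ℕ) (k : ι) (p : ENNReal) : MemLp (net.queueLen n k) p (accessLaw ι τ) :=
  (dependsOn_queueLen n k).memLp p

lemma ae_tendsto_queueLen_div (hdirect : ∀ k h, net.helper k = some h → net.helper h = none)
    (k : ι) :
    ∀ᵐ ω ∂(accessLaw ι τ), Tendsto (fun n : ℕ => net.queueLen n k ω / n) atTop (𝓝 0) := by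
  have h := ae_tendsto_zero_of_summable_integral_sq (μ := accessLaw ι τ)
    (W := fun n ω => net.queueLen (n + 1) k ω / ((n : ℝ) + 1))
    (b := fun n => (2 * (net.helpedCount k : ℝ) ^ 2 + net.helpedCount k) / ((n : ℝ) + 1) ^ 2)
    (fun n => by
      simp_rw [div_pow]
      exact (memLp_queueLen τ (n + 1) k 2).integrable_sq.div_const _)
    (summable_const_div_succ_sq _) (fun n => by
      simp_rw [div_pow]
      rw [integral_div]
      exact div_le_div_of_nonneg_right (integral_queueLen_sq_le τ hdirect (n + 1) k)
        (by positivity))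
  filter_upwards [h] with ω hω
  refine (tendsto_add_atTop_iff_nat 1).1 ?_
  simpa using hω

/-- Summing the recursion of the queue length gives
`p ∑ X_m = ∑ (arrivals) + ∑ X_m (p - [success of k in phase m]) - X_n`. As the decisions in phase
`m` are independent of `X_m`, the terms of the second sum on the right are orthogonal. -/
lemma ae_tendsto_average_queueLen
    (hdirect : ∀ k h, net.helper k = some h → net.helper h = none)
    (h0 : 0 < (τ : ℝ)) (h1 : (τ : ℝ) < 1) (k : ι) :
    ∀ᵐ ω ∂(accessLaw ι τ), Tendsto
      (fun n : ℕ => (∑ m ∈ Finset.range n, net.queueLen m k ω) / n) atTop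
      (𝓝 (net.helpedCount k : ℝ)) := by
  have hp := successProb_pos (ι := ι) h0 h1
  set p := successProb ι (τ : ℝ) with hp_def
  set g : (ι → Bool) → ℝ := fun a => p - successInd k a with hg
  have hg0 : ∫ a, g a ∂(Measure.infinitePi fun _ : ι => bernoulliMeasure true false τ) = 0 := by
    rw [hg, integral_sub Integrable.of_finite Integrable.of_finite, integral_successInd]
    simp [hp_def]
  have hdep : ∀ m, DependsOn (fun ω => net.queueLen m k ω * g (ω m))
      (Finset.range (m + 1) : Set ℕ) := fun m x y h => by
    simp only
    rw [dependsOn_queueLen m k fun i hi => h i ?_, h m (by simp)]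
    simp only [Finset.coe_range, Set.mem_Iio] at hi ⊢
    omega
  have horth : ∀ᵐ ω ∂(accessLaw ι τ), Tendsto
      (fun n : ℕ => (∑ m ∈ Finset.range n, net.queueLen m k ω * g (ω m)) / n) atTop (𝓝 0) := by
    refine ae_tendsto_average_of_uncorrelated (L := 0)
      (C := 2 * (net.helpedCount k : ℝ) ^ 2 + net.helpedCount k)
      (fun m => (hdep m).memLp 2) (by positivity) (fun m => ?_) fun i j hij => ?_
    · refine le_trans (integral_mono ?_ (memLp_queueLen τ m k 2).integrable_sq fun ω => ?_)
        (integral_queueLen_sq_le τ hdirect m k)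
      · exact ((hdep m).memLp 2).integrable_sq
      · have a1 := successInd_nonneg k (ω m)
        have a2 := successInd_le_one k (ω m)
        have a3 := (successProb_le (ι := ι) τ).trans τ.2.2
        have : g (ω m) ^ 2 ≤ 1 := by
          rw [sq_le_one_iff_abs_le_one, abs_le]
          constructor <;> simp only [hg] <;> linarith
        simp only [mul_pow]
        exact mul_le_of_le_one_right (sq_nonneg _) this
    · have hij' : DependsOn (fun ω => net.queueLen i k ω * g (ω i) * net.queueLen j k ω)
          (Finset.range j : Set ℕ) := fun x y h => by
        have hi : net.queueLen i k x * g (x i) = net.queueLen i k y * g (y i) :=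
          hdep i fun l hl => h l (by
            simp only [Finset.coe_range, Set.mem_Iio] at hl ⊢
            omega)
        simp only [hi, dependsOn_queueLen j k h]
      have := DependsOn.integral_mul (ν := Measure.infinitePi fun _ : ι =>
        bernoulliMeasure true false τ) hij' (dependsOn_eval g j) (by simp)
      have he := integral_accessLaw_eval τ g j
      rw [hg0] at he
      rw [← accessLaw, he, mul_zero] at this
      rw [← this]
      refine integral_congr_ae (ae_of_all _ fun ω => ?_)
      ring
  filter_upwards [horth, ae_tendsto_average_eval τ (net.arrivalInd k),
    ae_tendsto_queueLen_div τ hdirect k] with ω hZ hb hX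
  rw [integral_arrivalInd, ← hp_def] at hb
  have hsum : ∀ n, p * ∑ m ∈ Finset.range n, net.queueLen m k ω =
      ∑ m ∈ Finset.range n, net.arrivalInd k (ω m) +
        ∑ m ∈ Finset.range n, net.queueLen m k ω * g (ω m) - net.queueLen n k ω := by
    intro n
    induction n with
    | zero => simp [queueLen, queues]
    | succ n ih =>
      rw [Finset.sum_range_succ, Finset.sum_range_succ, Finset.sum_range_succ, mul_add, ih,
        queueLen_succ hdirect]
      simp only [hg]
      ring
  have hlim := ((hb.add hZ).sub hX).div_const p
  have hval : (p * (net.helpedCount k : ℝ) + 0 - 0) / p = net.helpedCount k := by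
    field_simp
    ring
  rw [hval] at hlim
  refine hlim.congr fun n => ?_
  rw [← add_div, ← sub_div, ← hsum]
  field_simp

/-- An ergodic theorem: averages of a function `f` of the queues and of the access decisions
converge to the limit of the means. Here, `f` may grow linearly with the queue lengths.

The queues are compared with those that were empty `L` phases earlier. Averages of functionals of
the latter converge by the law of large numbers for functionals of finitely many coordinates, and
the average difference of the queue lengths tends to `H_k - E[X_k(L)]`, which is small for large
`L`. -/
lemma exists_tendsto_average (hdirect : ∀ k h, net.helper k = some h → net.helper h = none)
    (h0 : 0 < (τ : ℝ)) (h1 : (τ : ℝ) < 1) (f : (ι → List ι) → (ι → Bool) → ℝ) (C : ℝ)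
    (hf : ∀ q q' a, |f q a - f q' a| ≤
      C * ∑ k, |((q k).length : ℝ) - ((q' k).length : ℝ)|) :
    ∃ l, Tendsto (fun m => ∫ ω, f (net.queues ⊤ ⊤ ω m) (ω m) ∂(accessLaw ι τ)) atTop (𝓝 l) ∧
      ∀ᵐ ω ∂(accessLaw ι τ), Tendsto
        (fun n : ℕ => (∑ m ∈ Finset.range n, f (net.queues ⊤ ⊤ ω m) (ω m)) / n) atTop (𝓝 l) := by
  set F : ℕ → (ℕ → ι → Bool) → ℝ := fun L ω => f (net.queues ⊤ ⊤ ω L) (ω L) with hF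
  set e : ℕ → ℝ := fun L => ∫ ω, F L ω ∂(accessLaw ι τ) with he
  set ε : ℕ → ℝ := fun L => C * ∑ k, ((net.helpedCount k : ℝ) -
    ∫ ω, net.queueLen L k ω ∂(accessLaw ι τ)) with hε_def
  have hε : Tendsto ε atTop (𝓝 0) := by
    have : Tendsto ε atTop (𝓝 (C * ∑ k : ι, ((net.helpedCount k : ℝ) - net.helpedCount k))) :=
      (tendsto_finsetSum _ fun k _ =>
        (tendsto_integral_queueLen τ hdirect h0 h1 k).const_sub _).const_mul C
    simpa using this
  have hFdep : ∀ L, DependsOn (F L) (Finset.range (L + 1) : Set ℕ) := fun L x y h => by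
    simp only [hF]
    rw [queues_congr net fun i hi => h i ?_, h L (by simp)]
    simp only [Finset.coe_range, Set.mem_Iio]
    omega
  have hFae : ∀ᵐ ω ∂(accessLaw ι τ), ∀ L, Tendsto
      (fun n : ℕ => (∑ m ∈ Finset.range n, F L (shiftSeq m ω)) / n) atTop (𝓝 (e L)) :=
    ae_all_iff.2 fun L => ae_tendsto_average_window (hFdep L)
  have hQae : ∀ᵐ ω ∂(accessLaw ι τ), ∀ L k, Tendsto
      (fun n : ℕ => (∑ m ∈ Finset.range n, net.queueLen L k (shiftSeq m ω)) / n) atTop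
      (𝓝 (∫ ω, net.queueLen L k ω ∂(accessLaw ι τ))) :=
    ae_all_iff.2 fun L => ae_all_iff.2 fun k => ae_tendsto_average_window (dependsOn_queueLen L k)
  have hXae : ∀ᵐ ω ∂(accessLaw ι τ), ∀ k, Tendsto
      (fun n : ℕ => (∑ m ∈ Finset.range n, net.queueLen m k ω) / n) atTop
      (𝓝 (net.helpedCount k : ℝ)) :=
    ae_all_iff.2 fun k => ae_tendsto_average_queueLen τ hdirect h0 h1 k
  have hmain : ∀ᵐ ω ∂(accessLaw ι τ), ∃ l, Tendsto e atTop (𝓝 l) ∧ Tendsto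
      (fun n : ℕ => (∑ m ∈ Finset.range n, F m ω) / n) atTop (𝓝 l) := by
    filter_upwards [hFae, hQae, hXae] with ω hFω hQω hXω
    refine exists_tendsto_of_approx hε fun L δ hδ => ?_
    refine eventually_abs_average_sub_le_of_shift L (fun δ hδ => ?_) hδ
    have hdiff : Tendsto (fun n : ℕ => C * ∑ k,
        ((∑ m ∈ Finset.range n, net.queueLen (m + L) k ω) / (n : ℝ) -
          (∑ m ∈ Finset.range n, net.queueLen L k (shiftSeq m ω)) / n)) atTop (𝓝 (ε L)) :=
      (tendsto_finsetSum _ fun k _ =>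
        (tendsto_average_shift L (hXω k)).sub (hQω L k)).const_mul C
    filter_upwards [hdiff.eventually (ge_mem_nhds (lt_add_of_pos_right _ (half_pos hδ))),
      Metric.tendsto_nhds.1 (hFω L) (δ / 2) (half_pos hδ)] with n hn1 hn2
    have hstep : ∀ m, |F (m + L) ω - F L (shiftSeq m ω)| ≤
        C * ∑ k, (net.queueLen (m + L) k ω - net.queueLen L k (shiftSeq m ω)) := fun m => by
      have h := hf (net.queues ⊤ ⊤ ω (m + L)) (net.queues ⊤ ⊤ (shiftSeq m ω) L) (ω (m + L))
      refine h.trans (le_of_eq ?_)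
      congr 1
      refine Finset.sum_congr rfl fun k _ => ?_
      exact abs_of_nonneg (sub_nonneg.2 (queueLen_shiftSeq_le hdirect m L k ω))
    have hsum : |(∑ m ∈ Finset.range n, F (m + L) ω) / n -
        (∑ m ∈ Finset.range n, F L (shiftSeq m ω)) / n| ≤ C * ∑ k,
        ((∑ m ∈ Finset.range n, net.queueLen (m + L) k ω) / (n : ℝ) -
          (∑ m ∈ Finset.range n, net.queueLen L k (shiftSeq m ω)) / n) := by
      rw [← sub_div, ← Finset.sum_sub_distrib, abs_div, Nat.abs_cast]
      simp_rw [← sub_div, ← Finset.sum_sub_distrib]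
      rw [← Finset.sum_div, Finset.sum_comm, ← mul_div_assoc, Finset.mul_sum]
      refine div_le_div_of_nonneg_right ?_ (Nat.cast_nonneg n)
      exact (Finset.abs_sum_le_sum_abs _ _).trans (Finset.sum_le_sum fun m _ => hstep m)
    rw [Real.dist_eq] at hn2
    have htri := abs_sub_le ((∑ m ∈ Finset.range n, F (m + L) ω) / n)
      ((∑ m ∈ Finset.range n, F L (shiftSeq m ω)) / n) (e L)
    linarith
  -- `e` does not depend on `ω`, hence neither does the limit
  obtain ⟨ω₀, l, hl, -⟩ := hmain.exists
  refine ⟨l, hl, ?_⟩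
  filter_upwards [hmain] with ω hω
  obtain ⟨l', hl', hω⟩ := hω
  rwa [tendsto_nhds_unique hl hl']

/-! ### Packet lengths -/

lemma packetDuration_pos {ι : Type*} {net : RelayNetwork ι} (hrate : ∀ k, 0 < net.rate k)
    (hlink : ∀ k l, k ≠ l → 0 < net.linkRate k l)
    (hdirect : ∀ k h, net.helper k = some h → net.helper h = none) (k : ι) :
    0 < net.packetDuration k := by
  unfold packetDuration
  rcases hk : net.helper k with _ | h
  · exact one_div_pos.2 (hrate k)
  · refine one_div_pos.2 (hlink k h ?_)
    rintro rfl
    exact helper_ne_self hdirect _ hk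

lemma packetLength_queues (hdirect : ∀ k h, net.helper k = some h → net.helper h = none)
    (n : ℕ) (k : ι) (ω : ℕ → ι → Bool) :
    net.packetLength ⊤ ⊤ (net.queues ⊤ ⊤ ω n) k =
      net.packetDuration k * (net.queueLen n k ω + 1) := by
  unfold packetLength packetDuration queueLen
  rcases hk : net.helper k with _ | h
  · simp only [nextHop_top, hk, jointPart_top]
    ring
  · simp [hk, queues_eq_nil_of_helper hdirect hk]

lemma abs_packetLength_sub_le {ι : Type*} [DecidableEq ι] {net : RelayNetwork ι}
    (hpd : ∀ k, 0 < net.packetDuration k) (q q' : ι → List ι) (k : ι) :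
    |net.packetLength ⊤ ⊤ q k - net.packetLength ⊤ ⊤ q' k| ≤
      net.packetDuration k * |((q k).length : ℝ) - ((q' k).length : ℝ)| := by
  have h := (hpd k).le
  unfold packetLength packetDuration at *
  rcases hk : net.helper k with _ | i
  · simp only [nextHop_top, hk, jointPart_top] at h ⊢
    rw [← sub_div, add_sub_add_right_eq_sub, div_eq_inv_mul, abs_mul, ← one_div, abs_of_nonneg h]
  · simp only [nextHop_top, hk, sub_self, abs_zero] at h ⊢
    positivity

lemma sum_abs_packetLength_sub_le (hpd : ∀ k, 0 < net.packetDuration k) (q q' : ι → List ι) :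
    ∑ k, |net.packetLength ⊤ ⊤ q k - net.packetLength ⊤ ⊤ q' k| ≤
      (∑ k, net.packetDuration k) * ∑ k, |((q k).length : ℝ) - ((q' k).length : ℝ)| := by
  rw [Finset.mul_sum]
  refine Finset.sum_le_sum fun k _ => (abs_packetLength_sub_le hpd q q' k).trans ?_
  exact mul_le_mul_of_nonneg_right
    (Finset.single_le_sum (fun j _ => (hpd j).le) (Finset.mem_univ k)) (abs_nonneg _)

lemma maxLength_le_add {ι : Type*} [Fintype ι] (u v : ι → ℝ) (A : Finset ι) :
    maxLength u A ≤ maxLength v A + ∑ k, |u k - v k| := by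
  unfold maxLength
  split_ifs with h
  · refine Finset.sup'_le h _ fun k hk => ?_
    have h1 := Finset.le_sup' v hk
    have h2 := Finset.single_le_sum (f := fun k => |u k - v k|) (fun _ _ => abs_nonneg _)
      (Finset.mem_univ k)
    have h3 := le_abs_self (u k - v k)
    linarith
  · simpa using Finset.sum_nonneg fun k _ => abs_nonneg (u k - v k)

lemma abs_maxLength_sub_le {ι : Type*} [Fintype ι] (u v : ι → ℝ) (A : Finset ι) :
    |maxLength u A - maxLength v A| ≤ ∑ k, |u k - v k| := by
  rw [abs_le]
  have h1 := maxLength_le_add u v A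
  have h2 := maxLength_le_add v u A
  simp_rw [abs_sub_comm (v _)] at h2
  constructor <;> linarith

lemma maxLength_transmitters_le {ι : Type*} [Fintype ι] {v : ι → ℝ} (hv : ∀ k, 0 ≤ v k)
    (a : ι → Bool) : maxLength v (transmitters a) ≤ ∑ k, v k * if a k = true then 1 else 0 := by
  have h0 : ∀ k ∈ Finset.univ, 0 ≤ v k * if a k = true then (1 : ℝ) else 0 := fun k _ =>
    mul_nonneg (hv k) (by split_ifs <;> norm_num)
  unfold maxLength
  split_ifs with h
  · refine Finset.sup'_le h _ fun k hk => ?_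
    have hk' : a k = true := by simpa [transmitters] using hk
    have := Finset.single_le_sum h0 (Finset.mem_univ k)
    simpa [hk'] using this
  · exact Finset.sum_nonneg h0

lemma sum_mul_successInd_le_maxLength {v : ι → ℝ} (hv : ∀ k, 0 ≤ v k) (a : ι → Bool) :
    ∑ k, v k * successInd k a ≤ maxLength v (transmitters a) := by
  rcases hs : soleTransmitter a with _ | i
  · simp only [successInd, hs, reduceCtorEq, if_false, mul_zero, Finset.sum_const_zero]
    unfold maxLength
    split_ifs with h
    · obtain ⟨k, hk⟩ := h
      exact (hv k).trans (Finset.le_sup' v hk)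
    · exact le_rfl
  · rw [soleTransmitter_eq_some_iff.1 hs]
    simp [successInd, hs, maxLength]

/-! ### Long-run averages of airtime, duration and delivered bits -/

/-- The steady-state mean of the sum of all packet lengths. -/
noncomputable def totalPacketLength (net : RelayNetwork ι) : ℝ :=
  ∑ k, net.packetDuration k * (net.helpedCount k + 1)

lemma integral_packetLength_mul_eval
    (hdirect : ∀ k h, net.helper k = some h → net.helper h = none) (m : ℕ) (k : ι)
    (g : (ι → Bool) → ℝ) :
    ∫ ω, net.packetLength ⊤ ⊤ (net.queues ⊤ ⊤ ω m) k * g (ω m) ∂(accessLaw ι τ) =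
      net.packetDuration k * ((∫ ω, net.queueLen m k ω ∂(accessLaw ι τ)) + 1) *
        ∫ a, g a ∂(Measure.infinitePi fun _ : ι => bernoulliMeasure true false τ) := by
  have h1 := integral_queueLen_pow_mul_eval (net := net) τ m 1 k g
  have h2 := integral_accessLaw_eval τ g m
  have i1 := integrable_queueLen_pow_mul_eval (net := net) τ m 1 k g
  have i2 := integrable_queueLen_pow_mul_eval (net := net) τ m 0 k g
  simp only [pow_one, pow_zero, one_mul] at h1 i1 i2
  rw [mul_assoc, add_mul, one_mul, ← h1, ← h2, ← integral_add i1 i2, ← integral_const_mul]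
  refine integral_congr_ae (ae_of_all _ fun ω => ?_)
  simp only [packetLength_queues hdirect]
  ring

lemma integrable_queues_eval (f : (ι → List ι) → (ι → Bool) → ℝ) (m : ℕ) :
    Integrable (fun ω => f (net.queues ⊤ ⊤ ω m) (ω m)) (accessLaw ι τ) := by
  refine DependsOn.integrable (s := Finset.range (m + 1)) fun x y h => ?_
  rw [queues_congr net fun i hi => h i ?_, h m (by simp)]
  simp only [Finset.coe_range, Set.mem_Iio]
  omega

lemma tendsto_integral_packetLength_mul_eval
    (hdirect : ∀ k h, net.helper k = some h → net.helper h = none)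
    (h0 : 0 < (τ : ℝ)) (h1 : (τ : ℝ) < 1) (k : ι) (g : (ι → Bool) → ℝ) :
    Tendsto (fun m => ∫ ω, net.packetLength ⊤ ⊤ (net.queues ⊤ ⊤ ω m) k * g (ω m) ∂(accessLaw ι τ))
      atTop (𝓝 (net.packetDuration k * (net.helpedCount k + 1) *
        ∫ a, g a ∂(Measure.infinitePi fun _ : ι => bernoulliMeasure true false τ))) := by
  simp_rw [integral_packetLength_mul_eval τ hdirect]
  exact (((tendsto_integral_queueLen τ hdirect h0 h1 k).add_const 1).const_mul _).mul_const _

lemma ae_tendsto_airtime_div (hdirect : ∀ k h, net.helper k = some h → net.helper h = none)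
    (hpd : ∀ k, 0 < net.packetDuration k)
    (h0 : 0 < (τ : ℝ)) (h1 : (τ : ℝ) < 1) (k : ι) :
    ∀ᵐ ω ∂(accessLaw ι τ), Tendsto (fun n : ℕ => net.airtime ⊤ ⊤ k n ω / n) atTop
      (𝓝 (net.packetDuration k * (net.helpedCount k + 1) * τ)) := by
  obtain ⟨l, hl, hae⟩ := exists_tendsto_average τ hdirect h0 h1 (net.phaseAirtime ⊤ ⊤ k)
    (∑ k, net.packetDuration k) fun q q' a => by
      refine le_trans ?_ (sum_abs_packetLength_sub_le hpd q q')
      unfold phaseAirtime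
      split_ifs
      · exact Finset.single_le_sum
          (f := fun k => |net.packetLength ⊤ ⊤ q k - net.packetLength ⊤ ⊤ q' k|)
          (fun _ _ => abs_nonneg _) (Finset.mem_univ k)
      · simpa using Finset.sum_nonneg fun k _ =>
          abs_nonneg (net.packetLength ⊤ ⊤ q k - net.packetLength ⊤ ⊤ q' k)
  have hlim := tendsto_integral_packetLength_mul_eval (net := net) τ hdirect h0 h1 k
    fun a => if a k = true then 1 else 0
  rw [integral_transmit] at hlim
  simp only [mul_ite, mul_one, mul_zero] at hlim
  rw [tendsto_nhds_unique hlim hl]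
  exact hae

/-- The mean duration of a phase. It lies between the contribution of the successful transmissions
alone and that of all transmitted packets, collisions counted with the sum of their lengths. -/
lemma exists_tendsto_elapsedTime_div
    (hdirect : ∀ k h, net.helper k = some h → net.helper h = none)
    (hpd : ∀ k, 0 < net.packetDuration k)
    (h0 : 0 < (τ : ℝ)) (h1 : (τ : ℝ) < 1) (σ : ℝ) :
    ∃ T, successProb ι τ * net.totalPacketLength + σ ≤ T ∧ T ≤ τ * net.totalPacketLength + σ ∧
      ∀ᵐ ω ∂(accessLaw ι τ), Tendsto (fun n : ℕ => net.elapsedTime ⊤ ⊤ σ n ω / n) atTop (𝓝 T) := by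
  obtain ⟨T, hT, hae⟩ := exists_tendsto_average τ hdirect h0 h1 (net.phaseDuration ⊤ ⊤ σ)
    (∑ k, net.packetDuration k) fun q q' a => by
      refine le_trans ?_ (sum_abs_packetLength_sub_le hpd q q')
      unfold phaseDuration
      rw [add_sub_add_right_eq_sub]
      exact abs_maxLength_sub_le _ _ _
  have hsum : ∀ g : ι → (ι → Bool) → ℝ, ∀ r : ℝ,
      (∀ k, ∫ a, g k a ∂(Measure.infinitePi fun _ : ι => bernoulliMeasure true false τ) = r) →
      Tendsto (fun m => ∫ ω, ((∑ k, net.packetLength ⊤ ⊤ (net.queues ⊤ ⊤ ω m) k * g k (ω m)) + σ)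
        ∂(accessLaw ι τ)) atTop (𝓝 (r * net.totalPacketLength + σ)) := by
    intro g r hg
    have hlim : Tendsto (fun m => (∑ k, ∫ ω, net.packetLength ⊤ ⊤ (net.queues ⊤ ⊤ ω m) k *
        g k (ω m) ∂(accessLaw ι τ)) + σ) atTop (𝓝 ((∑ k, net.packetDuration k *
          (net.helpedCount k + 1) * r) + σ)) :=
      (tendsto_finsetSum _ fun k _ => by
        have := tendsto_integral_packetLength_mul_eval (net := net) τ hdirect h0 h1 k (g k)
        rwa [hg k] at this).add_const σ
    rw [← Finset.sum_mul, mul_comm _ r] at hlim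
    refine hlim.congr fun m => ?_
    have hi : ∀ k, Integrable (fun ω => net.packetLength ⊤ ⊤ (net.queues ⊤ ⊤ ω m) k * g k (ω m))
        (accessLaw ι τ) := fun k =>
      integrable_queues_eval τ (fun q a => net.packetLength ⊤ ⊤ q k * g k a) m
    rw [integral_add (integrable_finsetSum _ fun k _ => hi k) (integrable_const σ),
      integral_finsetSum _ fun k _ => hi k]
    simp
  have hnn : ∀ m ω k, 0 ≤ net.packetLength ⊤ ⊤ (net.queues ⊤ ⊤ ω m) k := fun m ω k => by
    rw [packetLength_queues hdirect]
    exact mul_nonneg (hpd k).le (add_nonneg (net.queueLen_nonneg m k ω) zero_le_one)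
  refine ⟨T, ?_, ?_, hae⟩
  · refine le_of_tendsto_of_tendsto' (hsum successInd _ fun k => integral_successInd τ k) hT
      fun m => ?_
    refine integral_mono (integrable_queues_eval τ
      (fun q a => (∑ k, net.packetLength ⊤ ⊤ q k * successInd k a) + σ) m)
      (integrable_queues_eval τ (net.phaseDuration ⊤ ⊤ σ) m) fun ω => ?_
    exact add_le_add (sum_mul_successInd_le_maxLength (hnn m ω) (ω m)) le_rfl
  · refine le_of_tendsto_of_tendsto' hT
      (hsum (fun k a => if a k = true then 1 else 0) _ fun k => integral_transmit τ k) fun m => ?_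
    refine integral_mono (integrable_queues_eval τ (net.phaseDuration ⊤ ⊤ σ) m)
      (integrable_queues_eval τ (fun q a =>
        (∑ k, net.packetLength ⊤ ⊤ q k * if a k = true then 1 else 0) + σ) m) fun ω => ?_
    exact add_le_add (maxLength_transmitters_le (hnn m ω) (ω m)) le_rfl

/-- Delivered and successfully transmitted bits differ by the pending ones, of which there are
`o(n)`. -/
lemma ae_tendsto_deliveredBits_div
    (hdirect : ∀ k h, net.helper k = some h → net.helper h = none) (k : ι) :
    ∀ᵐ ω ∂(accessLaw ι τ), Tendsto (fun n : ℕ => (net.deliveredBits ⊤ ⊤ k n ω : ℝ) / n) atTop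
      (𝓝 (successProb ι τ)) := by
  filter_upwards [ae_tendsto_average_eval τ (successInd k),
    ae_all_iff.2 fun h => ae_tendsto_queueLen_div τ hdirect h] with ω hs hX
  rw [integral_successInd] at hs
  have hsumX : Tendsto (fun n : ℕ => ∑ h, net.queueLen n h ω / n) atTop (𝓝 0) := by
    simpa using tendsto_finsetSum Finset.univ fun h _ => hX h
  have hpend : Tendsto (fun n : ℕ => (net.pending (net.queues ⊤ ⊤ ω n) k : ℝ) / n) atTop (𝓝 0) := by
    refine squeeze_zero (fun n => by positivity) (fun n => ?_) hsumX
    rw [← Finset.sum_div]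
    exact div_le_div_of_nonneg_right (pending_le_sum_queueLen k n ω) (Nat.cast_nonneg n)
  have h := hs.sub hpend
  rw [sub_zero] at h
  refine h.congr fun n => ?_
  rw [← deliveredBits_add_pending, ← sub_div, add_sub_cancel_right]

lemma hasThroughput_of_tendsto (hdirect : ∀ k h, net.helper k = some h → net.helper h = none)
    {σ T : ℝ} (hT0 : 0 < T)
    (hT : ∀ᵐ ω ∂(accessLaw ι τ),
      Tendsto (fun n : ℕ => net.elapsedTime ⊤ ⊤ σ n ω / n) atTop (𝓝 T)) (k : ι) :
    net.HasThroughput ⊤ ⊤ σ τ k (successProb ι τ / T) := by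
  filter_upwards [hT, ae_tendsto_deliveredBits_div τ hdirect k] with ω h1 h2
  refine (h2.div h1 hT0.ne').congr' ?_
  filter_upwards [eventually_gt_atTop 0] with n hn
  exact div_div_div_cancel_right₀ (by exact_mod_cast hn.ne') _ _

lemma hasAveragePower_of_tendsto (hdirect : ∀ k h, net.helper k = some h → net.helper h = none)
    (hpd : ∀ k, 0 < net.packetDuration k) (h0 : 0 < (τ : ℝ)) (h1 : (τ : ℝ) < 1)
    {σ T : ℝ} (hT0 : 0 < T)
    (hT : ∀ᵐ ω ∂(accessLaw ι τ),
      Tendsto (fun n : ℕ => net.elapsedTime ⊤ ⊤ σ n ω / n) atTop (𝓝 T)) (k : ι) :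
    net.HasAveragePower ⊤ ⊤ σ τ k
      (net.power * (net.packetDuration k * (net.helpedCount k + 1) * τ) / T) := by
  filter_upwards [hT, ae_tendsto_airtime_div τ hdirect hpd h0 h1 k] with ω hω1 hω2
  refine ((hω2.const_mul net.power).div hω1 hT0.ne').congr' ?_
  filter_upwards [eventually_gt_atTop 0] with n hn
  simp only [Pi.div_apply, ← mul_div_assoc]
  exact div_div_div_cancel_right₀ (by exact_mod_cast hn.ne') _ _

/-! ### Steady-state means -/

/-- The queues before phase `m` are independent of the decisions in phase `m`. -/
lemma meanQueueAtTransmission_eq (h0 : 0 < (τ : ℝ)) (k : ι) (m : ℕ) :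
    net.meanQueueAtTransmission ⊤ ⊤ τ k m = ∫ ω, net.queueLen m k ω ∂(accessLaw ι τ) := by
  have hs : MeasurableSet {ω : ℕ → ι → Bool | ω m k = true} :=
    (measurableSet_singleton true).preimage (f := fun ω : ℕ → ι → Bool => ω m k) (by fun_prop)
  have hμ : (accessLaw ι τ).real {ω : ℕ → ι → Bool | ω m k = true} = τ := by
    rw [← integral_indicator_one hs, ← integral_transmit τ k,
      ← integral_accessLaw_eval τ (fun a => if a k = true then (1 : ℝ) else 0) m]
    refine integral_congr_ae (ae_of_all _ fun ω => ?_)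
    simp [Set.indicator_apply]
  have h := integral_queueLen_pow_mul_eval (net := net) τ m 1 k
    fun a => if a k = true then (1 : ℝ) else 0
  rw [integral_transmit] at h
  simp only [pow_one] at h
  have hint : ∫ ω in {ω : ℕ → ι → Bool | ω m k = true}, net.queueLen m k ω ∂(accessLaw ι τ) =
      (∫ ω, net.queueLen m k ω ∂(accessLaw ι τ)) * τ := by
    rw [← integral_indicator hs, ← h]
    refine integral_congr_ae (ae_of_all _ fun ω => ?_)
    simp [Set.indicator_apply]
  unfold meanQueueAtTransmission
  rw [ProbabilityTheory.cond, integral_smul_measure, ENNReal.toReal_inv, ← measureReal_def, hμ]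
  change (τ : ℝ)⁻¹ • ∫ ω in {ω : ℕ → ι → Bool | ω m k = true}, net.queueLen m k ω
    ∂(accessLaw ι τ) = _
  rw [hint, smul_eq_mul]
  field_simp

lemma tendsto_meanTotalPacketLength
    (hdirect : ∀ k h, net.helper k = some h → net.helper h = none)
    (h0 : 0 < (τ : ℝ)) (h1 : (τ : ℝ) < 1) :
    Tendsto (net.meanTotalPacketLength ⊤ ⊤ τ) atTop (𝓝 net.totalPacketLength) := by
  have h : Tendsto (fun m => ∑ k, ∫ ω, net.packetLength ⊤ ⊤ (net.queues ⊤ ⊤ ω m) k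
      ∂(accessLaw ι τ)) atTop (𝓝 net.totalPacketLength) :=
    tendsto_finsetSum _ fun k _ => by
      simpa using tendsto_integral_packetLength_mul_eval (net := net) τ hdirect h0 h1 k fun _ => 1
  refine h.congr fun m => ?_
  exact (integral_finsetSum _ fun k _ =>
    integrable_queues_eval τ (fun q _ => net.packetLength ⊤ ⊤ q k) m).symm

/-! ### Travel times -/

lemma helpedCount_eq_zero (hdirect : ∀ k h, net.helper k = some h → net.helper h = none)
    {k h : ι} (hk : net.helper k = some h) : net.helpedCount k = 0 := by
  unfold helpedCount
  rw [Finset.card_eq_zero, Finset.filter_eq_empty_iff]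
  intro j _ hj
  simp [hdirect j k hj] at hk

/-- Double counting: the time that a node spends on forwarding is charged to the nodes it helps. -/
lemma sum_travelTime (hdirect : ∀ k h, net.helper k = some h → net.helper h = none) :
    ∑ k, net.travelTime k = net.totalPacketLength := by
  have h1 : ∀ k, net.travelTime k =
      net.packetDuration k + ∑ h, if net.helper k = some h then net.packetDuration h else 0 := by
    intro k
    unfold travelTime
    rcases hk : net.helper k with _ | h
    · simp [packetDuration, hk]
    · have hh := hdirect k h hk
      simp [packetDuration, hk, hh]
  simp_rw [h1]
  rw [Finset.sum_add_distrib, Finset.sum_comm, ← Finset.sum_add_distrib]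
  refine Finset.sum_congr rfl fun k _ => ?_
  rw [← Finset.sum_filter, Finset.sum_const, nsmul_eq_mul, ← helpedCount]
  ring

lemma sum_travelTime_eq_direct_add_relayed {ι : Type*} [Fintype ι] (net : RelayNetwork ι) :
    ∑ k, net.travelTime k = ∑ k with net.helper k = none, 1 / net.rate k +
      ∑ k, ∑ h ∈ (net.helper k).toFinset, (1 / net.linkRate k h + 1 / net.rate h) := by
  rw [Finset.sum_filter, ← Finset.sum_add_distrib]
  refine Finset.sum_congr rfl fun k _ => ?_
  unfold travelTime
  rcases hk : net.helper k with _ | h <;> simp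

lemma rrBitCost_eq (hdirect : ∀ k h, net.helper k = some h → net.helper h = none)
    (hV : net.totalPacketLength ≠ 0) (k : ι) :
    net.rrBitCost k = (net.helpedCount k + 1) * net.packetDuration k * net.power := by
  have ht : net.rrTransmissionTime k = (net.helpedCount k + 1) * net.packetDuration k := by
    unfold rrTransmissionTime packetDuration
    rcases hk : net.helper k with _ | h
    · simp [div_eq_mul_inv]
    · simp [helpedCount_eq_zero hdirect hk]
  unfold rrBitCost rrAveragePower rrThroughput
  rw [ht, sum_travelTime hdirect]
  field_simp

/-! ### Limits for short slots -/

lemma tendsto_div_successProb (ι : Type*) [Fintype ι] :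
    Tendsto (fun τ : ℝ => τ / successProb ι τ) (𝓝[>] 0) (𝓝 1) := by
  have hcont : Tendsto (fun τ : ℝ => ((1 - τ) ^ (Fintype.card ι - 1))⁻¹) (𝓝[>] 0) (𝓝 1) := by
    have : Tendsto (fun τ : ℝ => (1 - τ) ^ (Fintype.card ι - 1)) (𝓝 0) (𝓝 1) := by
      have h : Continuous fun τ : ℝ => (1 - τ) ^ (Fintype.card ι - 1) := by fun_prop
      simpa using h.tendsto 0
    simpa using (this.mono_left nhdsWithin_le_nhds).inv₀ one_ne_zero
  refine hcont.congr' ?_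
  filter_upwards [self_mem_nhdsWithin] with τ hτ
  have hτ' : τ ≠ 0 := ne_of_gt hτ
  unfold successProb
  rw [div_mul_eq_div_div, div_self hτ', one_div]

variable {c : ℝ}

lemma tendsto_const_mul_sqrt (hc : 0 < c) :
    Tendsto (fun σ : ℝ => c * √σ) (𝓝[>] 0) (𝓝[>] 0) := by
  refine tendsto_nhdsWithin_iff.2 ⟨?_, ?_⟩
  · have h : Continuous fun σ : ℝ => c * √σ := by fun_prop
    have := h.tendsto 0
    simp only [Real.sqrt_zero, mul_zero] at this
    exact this.mono_left nhdsWithin_le_nhds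
  · filter_upwards [self_mem_nhdsWithin] with σ hσ
    exact mul_pos hc (Real.sqrt_pos.2 hσ)

/-- With `τ = c √σ`, the slot length is `τ ^ 2 / c ^ 2`, of smaller order than `τ`. -/
lemma tendsto_slot_div_successProb (ι : Type*) [Fintype ι] (hc : 0 < c) :
    Tendsto (fun σ : ℝ => σ / successProb ι (c * √σ)) (𝓝[>] 0) (𝓝 0) := by
  have h1 := (tendsto_div_successProb ι).comp (tendsto_const_mul_sqrt hc)
  have h2 : Tendsto (fun σ : ℝ => c * √σ / c ^ 2) (𝓝[>] 0) (𝓝 0) := by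
    simpa using ((tendsto_const_mul_sqrt hc).mono_right nhdsWithin_le_nhds).div_const (c ^ 2)
  have h3 := h1.mul h2
  rw [mul_zero] at h3
  refine h3.congr' ?_
  filter_upwards [self_mem_nhdsWithin] with σ hσ
  have hsq : √σ * √σ = σ := Real.mul_self_sqrt (le_of_lt hσ)
  simp only [Function.comp_apply]
  rw [div_mul_eq_mul_div]
  congr 1
  field_simp
  rw [sq, hsq]

lemma eventually_const_mul_sqrt_mem (hc : 0 < c) :
    ∀ᶠ σ : ℝ in 𝓝[>] 0, 0 < σ ∧ 0 < c * √σ ∧ c * √σ < 1 := by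
  filter_upwards [self_mem_nhdsWithin,
    (tendsto_const_mul_sqrt hc).eventually (Ioo_mem_nhdsGT zero_lt_one)] with σ h1 h2
  exact ⟨h1, h2⟩

lemma tendsto_coopThroughput (hdirect : ∀ k h, net.helper k = some h → net.helper h = none)
    (hV : net.totalPacketLength ≠ 0) (hc : 0 < c) :
    Tendsto (fun σ => net.coopThroughput σ (c * √σ)) (𝓝[>] 0)
      (𝓝 (1 / net.totalPacketLength)) := by
  have hτ0 : Tendsto (fun σ : ℝ => c * √σ) (𝓝[>] 0) (𝓝 0) :=
    (tendsto_const_mul_sqrt hc).mono_right nhdsWithin_le_nhds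
  have hτp : Tendsto (fun σ : ℝ => c * √σ / successProb ι (c * √σ)) (𝓝[>] 0) (𝓝 1) :=
    (tendsto_div_successProb ι).comp (tendsto_const_mul_sqrt hc)
  have hσ : Tendsto (fun σ : ℝ => σ) (𝓝[>] 0) (𝓝 0) := tendsto_id.mono_left nhdsWithin_le_nhds
  have hsucc : Tendsto (fun σ => ∑ k, (net.travelTime k + σ)) (𝓝[>] 0)
      (𝓝 net.totalPacketLength) := by
    rw [← sum_travelTime hdirect]
    simpa using tendsto_finsetSum Finset.univ fun k _ => hσ.const_add (net.travelTime k)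
  have hcoll : Tendsto (fun σ => net.coopCollisionTime σ (c * √σ) / successProb ι (c * √σ))
      (𝓝[>] 0) (𝓝 0) := by
    unfold coopCollisionTime
    simp_rw [Finset.sum_div]
    suffices hterm : ∀ A ∈ (Finset.univ : Finset ι).powerset.filter (fun A => 2 ≤ A.card),
        Tendsto (fun σ => (c * √σ) ^ A.card * (1 - c * √σ) ^ (Fintype.card ι - A.card) *
          (maxLength net.packetDuration A + σ) / successProb ι (c * √σ)) (𝓝[>] 0) (𝓝 0) by
      simpa using tendsto_finsetSum _ hterm
    intro A hA
    -- at least one factor `τ` remains after division by the success probability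
    obtain ⟨j, hj⟩ : ∃ j, A.card = j + 1 + 1 :=
      ⟨A.card - 2, by have := (Finset.mem_filter.1 hA).2; omega⟩
    have h := ((hτ0.pow (j + 1)).mul (hτp.mul ((hτ0.const_sub 1).pow
      (Fintype.card ι - A.card)))).mul (hσ.const_add (maxLength net.packetDuration A))
    rw [zero_pow j.succ_ne_zero, zero_mul, zero_mul] at h
    refine h.congr fun σ => ?_
    rw [hj, pow_succ (c * √σ) (j + 1)]
    ring
  have hidle : Tendsto (fun σ => coopIdleTime ι σ (c * √σ) / successProb ι (c * √σ))
      (𝓝[>] 0) (𝓝 0) := by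
    have h := ((hτ0.const_sub 1).pow (Fintype.card ι)).mul (tendsto_slot_div_successProb ι hc)
    rw [mul_zero] at h
    refine h.congr fun σ => ?_
    unfold coopIdleTime
    ring
  have h := ((hsucc.add hcoll).add hidle)
  rw [add_zero, add_zero] at h
  have h' := h.inv₀ hV
  rw [← one_div] at h'
  refine h'.congr' ?_
  filter_upwards [eventually_const_mul_sqrt_mem hc] with σ hσ
  have hp : successProb ι (c * √σ) ≠ 0 := (successProb_pos hσ.2.1 hσ.2.2).ne'
  unfold coopThroughput coopSuccessTime
  rw [← Finset.mul_sum, ← inv_div _ (successProb ι (c * √σ)), add_div, add_div,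
    mul_div_cancel_left₀ _ hp]

lemma tendsto_coopBitCost (hc : 0 < c) (k : ι) :
    Tendsto (fun σ => net.coopBitCost (c * √σ) k) (𝓝[>] 0)
      (𝓝 ((net.helpedCount k + 1) * net.packetDuration k * net.power)) :=
  ((((tendsto_div_successProb ι).comp (tendsto_const_mul_sqrt hc)).const_add _).mul_const
    _).mul_const _

end RelayNetwork

open RelayNetwork

theorem proposition3 {ι : Type*} [Fintype ι] [DecidableEq ι] [Nonempty ι] (net : RelayNetwork ι)
    (hrate : ∀ k, 0 < net.rate k)
    (hlink : ∀ k l, k ≠ l → 0 < net.linkRate k l)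
    (hhelper : net.HelpersAreBestRelays)
    (hdirect : ∀ k h, net.helper k = some h → net.helper h = none)
    (c : ℝ) (hc : 0 < c) :
    ∃ (S : ℝ → ℝ) (B : ι → ℝ → ℝ) (V : ℝ),
      -- for each admissible pair of parameters, fairMAC has throughput `S σ` and bit-costs `B k σ`,
      -- the mean queue length seen by a transmitting node is its number of helped nodes, and the
      -- mean of the sum of the packet lengths is `V`
      (∀ (σ : ℝ) (τ : unitInterval), 0 < σ → (τ : ℝ) = c * √σ → (τ : ℝ) < 1 →
        (∀ k, net.HasThroughput ⊤ ⊤ σ τ k (S σ)) ∧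
        (∀ k, net.HasBitCost ⊤ ⊤ σ τ k (B k σ)) ∧
        (∀ k, Tendsto (net.meanQueueAtTransmission ⊤ ⊤ τ k) atTop (𝓝 (net.helpedCount k : ℝ))) ∧
        Tendsto (net.meanTotalPacketLength ⊤ ⊤ τ) atTop (𝓝 V)) ∧
      -- asymptotic throughput
      Tendsto S (𝓝[>] 0) (𝓝 (1 / V)) ∧
      1 / V = 1 / (∑ k with net.helper k = none, 1 / net.rate k +
        ∑ k, ∑ h ∈ (net.helper k).toFinset, (1 / net.linkRate k h + 1 / net.rate h)) ∧
      1 / V = net.rrThroughput ∧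
      Tendsto (fun σ => net.coopThroughput σ (c * √σ)) (𝓝[>] 0) (𝓝 (1 / V)) ∧
      -- asymptotic bit-cost
      ∀ k, Tendsto (B k) (𝓝[>] 0)
          (𝓝 ((net.helpedCount k + 1) * net.packetDuration k * net.power)) ∧
        (net.helpedCount k + 1) * net.packetDuration k * net.power = net.rrBitCost k ∧
        Tendsto (fun σ => net.coopBitCost (c * √σ) k) (𝓝[>] 0)
          (𝓝 ((net.helpedCount k + 1) * net.packetDuration k * net.power)) := by
  have hpd := packetDuration_pos hrate hlink hdirect
  have hVpos : 0 < net.totalPacketLength :=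
    Finset.sum_pos (fun k _ => mul_pos (hpd k) (by positivity)) Finset.univ_nonempty
  -- mean phase duration as a function of `σ` alone; at inadmissible `σ` the value is irrelevant
  have hT : ∀ σ : ℝ, ∃ T : ℝ, ∀ τ : unitInterval, 0 < σ → (τ : ℝ) = c * √σ → (τ : ℝ) < 1 →
      successProb ι τ * net.totalPacketLength + σ ≤ T ∧ T ≤ τ * net.totalPacketLength + σ ∧
      ∀ᵐ ω ∂(accessLaw ι τ), Tendsto (fun n : ℕ => net.elapsedTime ⊤ ⊤ σ n ω / n) atTop (𝓝 T) := by
    intro σ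
    by_cases h : 0 < σ ∧ c * √σ < 1
    · have h0 : 0 < c * √σ := mul_pos hc (Real.sqrt_pos.2 h.1)
      obtain ⟨T, hT⟩ := exists_tendsto_elapsedTime_div (net := net) ⟨c * √σ, h0.le, h.2.le⟩
        hdirect hpd h0 h.2 σ
      refine ⟨T, fun τ _ hτ _ => ?_⟩
      obtain rfl : τ = ⟨c * √σ, h0.le, h.2.le⟩ := Subtype.ext hτ
      exact hT
    · exact ⟨0, fun τ hσ hτ hτ1 => absurd ⟨hσ, hτ ▸ hτ1⟩ h⟩
  choose T hT using hT
  have hVsum : ∑ k, net.travelTime k = net.totalPacketLength := sum_travelTime hdirect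
  refine ⟨fun σ => successProb ι (c * √σ) / T σ, fun k σ => net.power *
    (net.packetDuration k * (net.helpedCount k + 1) * (c * √σ)) / successProb ι (c * √σ),
    net.totalPacketLength, fun σ τ hσ hτ hτ1 => ?_, ?_, ?_, ?_,
    tendsto_coopThroughput hdirect hVpos.ne' hc,
    fun k => ⟨?_, (rrBitCost_eq hdirect hVpos.ne' k).symm, tendsto_coopBitCost hc k⟩⟩
  · have h0 : 0 < (τ : ℝ) := hτ ▸ mul_pos hc (Real.sqrt_pos.2 hσ)
    obtain ⟨hlo, -, hae⟩ := hT σ τ hσ hτ hτ1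
    have hp := successProb_pos (ι := ι) h0 hτ1
    have hT0 : 0 < T σ := lt_of_lt_of_le (by positivity) hlo
    simp only [← hτ]
    have hS := hasThroughput_of_tendsto (net := net) τ hdirect hT0 hae
    refine ⟨hS, fun k => ⟨_, _, hasAveragePower_of_tendsto τ hdirect hpd h0 hτ1 hT0 hae k, hS k,
      div_pos hp hT0, ?_⟩, fun k => ?_, tendsto_meanTotalPacketLength τ hdirect h0 hτ1⟩
    · exact (div_div_div_cancel_right₀ hT0.ne' _ _).symm
    · exact (tendsto_integral_queueLen τ hdirect h0 hτ1 k).congr fun m =>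
        (meanQueueAtTransmission_eq τ h0 k m).symm
  · have hσp := tendsto_slot_div_successProb ι hc
    have hτp := (tendsto_div_successProb ι).comp (tendsto_const_mul_sqrt hc)
    -- `V + σ / p ≤ T / p ≤ (τ / p) V + σ / p`, where `p` is the success probability
    have hlim : Tendsto (fun σ => T σ / successProb ι (c * √σ)) (𝓝[>] 0)
        (𝓝 net.totalPacketLength) := by
      have hlo := hσp.const_add net.totalPacketLength
      have hhi := (hτp.mul_const net.totalPacketLength).add hσp
      rw [add_zero] at hlo
      rw [add_zero, one_mul] at hhi
      refine tendsto_of_tendsto_of_tendsto_of_le_of_le' hlo hhi ?_ ?_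
      · filter_upwards [eventually_const_mul_sqrt_mem hc] with σ hσ
        have hp := successProb_pos (ι := ι) hσ.2.1 hσ.2.2
        have h := (hT σ ⟨c * √σ, hσ.2.1.le, hσ.2.2.le⟩ hσ.1 rfl hσ.2.2).1
        rw [le_div_iff₀ hp, add_mul, div_mul_cancel₀ _ hp.ne', mul_comm]
        exact h
      · filter_upwards [eventually_const_mul_sqrt_mem hc] with σ hσ
        have hp := successProb_pos (ι := ι) hσ.2.1 hσ.2.2
        have h := (hT σ ⟨c * √σ, hσ.2.1.le, hσ.2.2.le⟩ hσ.1 rfl hσ.2.2).2.1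
        simp only [Function.comp_apply]
        rw [div_mul_eq_mul_div, ← add_div]
        exact div_le_div_of_nonneg_right h hp.le
    have h := hlim.inv₀ hVpos.ne'
    rw [← one_div] at h
    exact h.congr fun σ => inv_div _ _
  · rw [← sum_travelTime_eq_direct_add_relayed, hVsum]
  · rw [rrThroughput, hVsum]
  · have hτp := (tendsto_div_successProb ι).comp (tendsto_const_mul_sqrt hc)
    have h := hτp.const_mul ((net.helpedCount k + 1) * net.packetDuration k * net.power)
    rw [mul_one] at h
    refine h.congr fun σ => ?_
    simp only [Function.comp_apply]
    ring
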